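/- Let $P\subset\mathbb{R}^n$ be a lattice polytope (the convex hull of finitely many points of $\mathbb{Z}^n$) and let $c$ be a positive integer. A \emph{lattice triangulation} $\mathcal{T}$ of a lattice polytope $Q$ is a finite collection of simplices with vertices in $\mathbb{Z}^n$, closed under taking faces, any two meeting in a common (possibly empty) face, with union $Q$. It is \emph{unimodular} if each maximal simplex $\Delta$, of dimension $d$ say, is the image of $\operatorname{conv}\{0,e_1,\dots,e_d\}\subset\mathbb{R}^d$ under an injective affine map carrying $\mathbb{Z}^d$ onto $\mathbb{Z}^n\cap\operatorname{aff}(\Delta)$; \emph{regular} if there are weights $\omega\in\mathbb{R}^{Q\cap\mathbb{Z}^n}$ such that the nonempty simplices of $\mathcal{T}$ are exactly the nonempty sets of the form $\operatorname{conv}\{a\in Q\cap\mathbb{Z}^n:\omega_a=\langle\eta,a\rangle+\zeta\}$, where $\eta\in\mathbb{R}^n$, $\zeta\in\mathbb{R}$ satisfy $\omega_a\ge\langle\eta,a\rangle+\zeta$ for all $a\in Q\cap\mathbb{Z}^n$; \emph{flag} if every minimal set of vertices of $\mathcal{T}$ that is not the vertex set of a (possibly empty) simplex of $\mathcal{T}$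 has exactly two elements; and \emph{quadratic} if it is regular, unimodular and flag. For a simplex $\Delta=\operatorname{conv}\{a_0,\dots,a_d\}$ with ordered vertices $a_0,\dots,a_d$, consider the affine isomorphism $\operatorname{aff}(c\Delta)\to\operatorname{aff}(c\Delta_{\mathbf A}^d)$, $c\,a_i\mapsto c\sum_{j=1}^{i+1}e_j\in\mathbb{R}^{d+1}$, where $\Delta_{\mathbf A}^d=\operatorname{conv}\{\sum_{j=1}^{i+1}e_j:0\le i\le d\}$. The \emph{canonical triangulation} of $c\Delta$ is the pull-back under this map of the subdivision of $c\Delta_{\mathbf A}^d$ (including all its faces) obtained by slicing along all hyperplanes $z_i-z_j=k$ with $1\le i<j\le d+1$ and $k\in\mathbb{Z}$. \textbf{Theorem.} Let $\mathcal{T}$ be a lattice triangulation of $P$ and fix a total order on the vertices of $\mathcal{T}$, so that every $\Delta\in\mathcal{T}$ is an ordered simplex. Let $\mathcal{T}'$ be the union, over all nonempty $\Delta\in\mathcal{T}$, of the canonical triangulations of $c\Delta$. Then: \begin{enumerate} \item $\mathcal{T}'$ (together with the empty face) is a lattice triangulation of $cP$, and for every nonempty $\Delta\in\mathcal{T}$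 the nonempty simplices of $\mathcal{T}'$ contained in $c\Delta$ are exactly those of the canonical triangulation of $c\Delta$ (so common faces of different simplices of $c\mathcal{T}=\{c\Delta:\Delta\in\mathcal{T}\}$ get the same refinement); \item if $\mathcal{T}$ is unimodular, then $\mathcal{T}'$ is unimodular; \item if $\mathcal{T}$ is regular, then $\mathcal{T}'$ is regular; \item if $\mathcal{T}$ is flag, then $\mathcal{T}'$ is flag. \end{enumerate} In particular, if $P$ has a quadratic triangulation, then so does $cP$ for every positive integer $c$. -/

import Mathlib

open Geometry
open scoped Pointwise

namespace LatticeTriang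

/-- The lattice `ℤⁿ` inside `ℝⁿ`. -/
def latticePoints (n : ℕ) : Set (Fin n → ℝ) :=
  {x | ∀ i, ∃ k : ℤ, x i = (k : ℝ)}

/-- A lattice polytope: the convex hull of finitely many lattice points. -/
def IsLatticePolytope {n : ℕ} (P : Set (Fin n → ℝ)) : Prop :=
  ∃ V : Finset (Fin n → ℝ), (V : Set (Fin n → ℝ)) ⊆ latticePoints n ∧
    P = convexHull ℝ (V : Set (Fin n → ℝ))

/-- The polytopes (nonempty simplices) of a simplicial complex, as subsets of space. -/
def simplices {n : ℕ} (T : SimplicialComplex ℝ (Fin n → ℝ)) : Set (Set (Fin n → ℝ)) :=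
  (fun s : Finset (Fin n → ℝ) => convexHull ℝ (s : Set (Fin n → ℝ))) '' T.faces

/-- `T` is a lattice triangulation of `P`: a finite geometric simplicial complex with vertices
in the lattice and with union `P`. -/
structure IsLatticeTriangulation {n : ℕ} (T : SimplicialComplex ℝ (Fin n → ℝ))
    (P : Set (Fin n → ℝ)) : Prop where
  finite : T.faces.Finite
  vertices_subset : T.vertices ⊆ latticePoints n
  space_eq : T.space = P

/-- The standard simplex `conv {0, e₁, …, e_d}` in `ℝᵈ`. -/
def standardSimplex (d : ℕ) : Set (Fin d → ℝ) :=
  convexHull ℝ (insert 0 (Set.range fun i : Fin d => (Pi.single i 1 : Fin d → ℝ)))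

/-- A unimodular simplex: lattice equivalent to a standard simplex, that is, its image under an
injective affine map which carries `ℤᵈ` onto the lattice points of the affine hull. -/
def IsUnimodularSimplex {n : ℕ} (D : Set (Fin n → ℝ)) : Prop :=
  ∃ (d : ℕ) (f : (Fin d → ℝ) →ᵃ[ℝ] (Fin n → ℝ)), Function.Injective f ∧
    f '' latticePoints d = latticePoints n ∩ (affineSpan ℝ D : Set (Fin n → ℝ)) ∧
    f '' standardSimplex d = D

/-- Every cell (maximal simplex) is unimodular. -/
def IsUnimodular {n : ℕ} (T : SimplicialComplex ℝ (Fin n → ℝ)) : Prop :=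
  ∀ s ∈ T.facets, IsUnimodularSimplex (convexHull ℝ (s : Set (Fin n → ℝ)))

/-- The nonempty faces of the subdivision of `P` induced by the weights `w` on the lattice points
of `P`. Only the values of `w` on these points matter. -/
def regularSubdivision {n : ℕ} (P : Set (Fin n → ℝ)) (w : (Fin n → ℝ) → ℝ) :
    Set (Set (Fin n → ℝ)) :=
  {F | F.Nonempty ∧ ∃ (η : Fin n → ℝ) (ζ : ℝ),
    (∀ a ∈ P ∩ latticePoints n, η ⬝ᵥ a + ζ ≤ w a) ∧
    F = convexHull ℝ {a | a ∈ P ∩ latticePoints n ∧ w a = η ⬝ᵥ a + ζ}}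

/-- The triangulation `T` of `P` is regular. -/
def IsRegular {n : ℕ} (T : SimplicialComplex ℝ (Fin n → ℝ)) (P : Set (Fin n → ℝ)) : Prop :=
  ∃ w : (Fin n → ℝ) → ℝ, simplices T = regularSubdivision P w

/-- `T` is flag: every minimal non-face (a set of vertices of `T` which is not a face although
all its proper subsets are) has exactly two elements. The empty set counts as a face. -/
def IsFlag {n : ℕ} (T : SimplicialComplex ℝ (Fin n → ℝ)) : Prop :=
  ∀ N : Finset (Fin n → ℝ), N.Nonempty → (N : Set (Fin n → ℝ)) ⊆ T.vertices → N ∉ T.faces →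
    (∀ M : Finset (Fin n → ℝ), M ⊂ N → M.Nonempty → M ∈ T.faces) → N.card = 2

/-- `T` is a quadratic triangulation of `P`: a regular unimodular flag lattice triangulation. -/
structure IsQuadraticTriangulation {n : ℕ} (T : SimplicialComplex ℝ (Fin n → ℝ))
    (P : Set (Fin n → ℝ)) : Prop where
  triangulation : IsLatticeTriangulation T P
  regular : IsRegular T P
  unimodular : IsUnimodular T
  flag : IsFlag T

/-- The vertex `e₀ + ⋯ + eᵢ` of the standard simplex of type `A` in `ℝ^(d+1)`
(coordinates numbered from `0`). -/
def typeAVertex (d : ℕ) (i : Fin (d + 1)) : Fin (d + 1) → ℝ :=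
  ∑ j ∈ Finset.Iic i, Pi.single j 1

/-- The standard `d`-simplex of type `A`. -/
def typeASimplex (d : ℕ) : Set (Fin (d + 1) → ℝ) :=
  convexHull ℝ (Set.range (typeAVertex d))

/-- The type `A` dicing of `P`, where the facets of `P` lie on lattice root hyperplanes
`zᵢ - zⱼ = k`, `k ∈ ℤ`: all nonempty faces of the subdivision of `P` obtained by slicing along
all these hyperplanes. The face whose relative interior contains `y` is cut out by bounding each
`zᵢ - zⱼ` by the floor and the ceiling of `yᵢ - yⱼ`. -/
def typeADicing {d : ℕ} (P : Set (Fin (d + 1) → ℝ)) : Set (Set (Fin (d + 1) → ℝ)) :=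
  {C | ∃ y ∈ P, C = {z | z ∈ P ∧ ∀ i j : Fin (d + 1),
    (⌊y i - y j⌋ : ℝ) ≤ z i - z j ∧ z i - z j ≤ (⌈y i - y j⌉ : ℝ)}}

/-- The (type `A`) canonical triangulation of `c • Δ`, where `Δ` is the ordered simplex with
vertices `a 0, …, a d` (affinely independent): the type `A` dicing of `c • typeASimplex d`,
transported by the affine isomorphism between `c • typeASimplex d` and `c • Δ` that matches
`c • typeAVertex d i` with `c • a i`, that is, `∑ xᵢ • typeAVertex d i` with `∑ xᵢ • a i`. -/
def canonicalTriangulation {n d : ℕ} (c : ℕ) (a : Fin (d + 1) → Fin n → ℝ) :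
    Set (Set (Fin n → ℝ)) :=
  {C | ∃ D ∈ typeADicing ((c : ℝ) • typeASimplex d),
    C = {p | ∃ x : Fin (d + 1) → ℝ, ∑ i, x i • typeAVertex d i ∈ D ∧ ∑ i, x i • a i = p}}

/-- `a 0 < ⋯ < a d` is the list of the vertices of a simplex of `T`, increasing in the given
total order on the vertices of `T`. -/
def IsOrderedFace {n d : ℕ} (T : SimplicialComplex ℝ (Fin n → ℝ)) (ord : LinearOrder T.vertices)
    (a : Fin (d + 1) → T.vertices) : Prop :=
  (∀ i j, i < j → ord.lt (a i) (a j)) ∧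
    ∃ s ∈ T.faces, (s : Set (Fin n → ℝ)) = Set.range fun i => (a i : Fin n → ℝ)

/-- The union of the canonical triangulations of the dilations `c • Δ` of all simplices `Δ` of
`T`, each `Δ` being ordered by a given total order on the vertices of `T`. -/
def canonicalRefinement {n : ℕ} (T : SimplicialComplex ℝ (Fin n → ℝ))
    (ord : LinearOrder T.vertices) (c : ℕ) : Set (Set (Fin n → ℝ)) :=
  {C | ∃ (d : ℕ) (a : Fin (d + 1) → T.vertices), IsOrderedFace T ord a ∧
    C ∈ canonicalTriangulation c (fun i => (a i : Fin n → ℝ))}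

end LatticeTriang

open LatticeTriang

/-! Let V be the ordered vertex set of `T`. A point of cσ, for a face σ, has a coordinate vector x
in ℝ^V with nonnegative entries, total c and support in σ. In these coordinates the type A
hyperplanes say that differences of upper partial sums of x (sums over upper sets of V) are
integers, a condition that does not mention σ. All canonical triangulations thus come from a single
arrangement on ℝ^V, and they agree on common faces because coordinate vectors are unique.

It remains to understand `cell x`. Shifting all upper sums by θ and rounding down gives an integral
point of the cell, and the average over θ in [0,1] is x; so a cell is the hull of its integral
points (`cell_eq_convexHull`). Integral points of one cell are pairwise `Compatible`, hence form a
chain for the order of upper sums, along which each upper sum rises by at most 1 in total. For each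
member m of such a chain, some difference of two upper sums is larger by exactly 1 at m than at
every other member (`exists_facet_functional`). Barycentric coordinates are therefore such
differences up to an integer constant (`exists_coefficient_formula`). This formula yields affine
independence, unimodularity, and the fact that the cell of a point has exactly the vertices of
positive weight (`integral_points_cell_eq`), so that cells meet in common faces.

Flagness passes to the refinement because compatibility is a condition on pairs, while the union of
pairwise admissible supports is a face by flagness of `T`. For regularity, the cells are the domains
of linearity of the convex function `cellWeight`; a small multiple of it is added to the linear
extension of the weights of `T`. -/

namespace LatticeTriang

/-! ### Cells of the arrangement of upper partial sums, and chains of compatible integral vectors.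
-/

section Cells

/-- A real vector all of whose entries are integers. -/
def IsIntegral {ι : Type*} (x : ι → ℝ) : Prop := ∀ v, ∃ k : ℤ, x v = k

theorem IsIntegral.exists_sum_eq {ι : Type*} {x : ι → ℝ} (hx : IsIntegral x) (U : Finset ι) :
    ∃ k : ℤ, ∑ v ∈ U, x v = k := by
  choose f hf using hx
  exact ⟨∑ v ∈ U, f v, by push_cast; exact Finset.sum_congr rfl fun v _ => hf v⟩

theorem finite_setOf_isIntegral_of_bounded {ι : Type*} [Finite ι] (l u : ι → ℝ) :
    {x : ι → ℝ | IsIntegral x ∧ ∀ i, l i ≤ x i ∧ x i ≤ u i}.Finite := by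
  refine (Set.Finite.pi' fun i => (Set.finite_Icc ⌈l i⌉ ⌊u i⌋).image
    (fun k : ℤ => (k : ℝ))).subset ?_
  rintro x ⟨hx, hb⟩ i
  obtain ⟨k, hk⟩ := hx i
  refine ⟨k, ⟨Int.ceil_le.2 (hk ▸ (hb i).1), Int.le_floor.2 (hk ▸ (hb i).2)⟩, hk.symm⟩

variable {V : Type*} [LinearOrder V]

/-- The closed cell, in the arrangement of all hyperplanes on which the difference of two upper
partial sums is an integer, which contains `x` in its relative interior. -/
def cell (x : V → ℝ) : Set (V → ℝ) :=
  {y | ∀ U W : Finset V, IsUpperSet (U : Set V) → IsUpperSet (W : Set V) →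
    ∑ v ∈ U, y v - ∑ v ∈ W, y v ≤ ⌈∑ v ∈ U, x v - ∑ v ∈ W, x v⌉}

theorem isUpperSet_coe_empty : IsUpperSet ((∅ : Finset V) : Set V) := by
  simp [isUpperSet_empty]

theorem mem_cell_self (x : V → ℝ) : x ∈ cell x := fun _ _ _ _ => Int.le_ceil _

theorem cell_subset_cell {x y : V → ℝ} (h : y ∈ cell x) : cell y ⊆ cell x := by
  intro z hz U W hU hW
  refine (hz U W hU hW).trans ?_
  exact_mod_cast Int.ceil_le.2 (h U W hU hW)

theorem convex_cell (x : V → ℝ) : Convex ℝ (cell x) := by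
  intro y hy z hz a b ha hb hab U W hU hW
  have h1 := mul_le_mul_of_nonneg_left (hy U W hU hW) ha
  have h2 := mul_le_mul_of_nonneg_left (hz U W hU hW) hb
  simp only [Pi.add_apply, Pi.smul_apply, smul_eq_mul, Finset.sum_add_distrib, ← Finset.mul_sum]
  have : (⌈∑ v ∈ U, x v - ∑ v ∈ W, x v⌉ : ℝ) = a * ⌈∑ v ∈ U, x v - ∑ v ∈ W, x v⌉ +
      b * ⌈∑ v ∈ U, x v - ∑ v ∈ W, x v⌉ := by rw [← add_mul, hab, one_mul]
  linarith

/-- Exchanging the two upper sets turns the ceiling bound into a floor bound, which is why `cell`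
needs only one of the two. -/
theorem floor_le_of_mem_cell {x y : V → ℝ} (h : y ∈ cell x) {U W : Finset V}
    (hU : IsUpperSet (U : Set V)) (hW : IsUpperSet (W : Set V)) :
    (⌊∑ v ∈ U, x v - ∑ v ∈ W, x v⌋ : ℝ) ≤ ∑ v ∈ U, y v - ∑ v ∈ W, y v := by
  have := h W U hW hU
  rw [← neg_sub (∑ v ∈ U, x v), Int.ceil_neg] at this
  push_cast at this
  linarith

/-- Upper partial sums of `y` exceed those of `x` by at least `0` and at most `1`. -/
def UnitStep (x y : V → ℝ) : Prop :=
  ∀ U : Finset V, IsUpperSet (U : Set V) →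
    ∑ v ∈ U, x v ≤ ∑ v ∈ U, y v ∧ ∑ v ∈ U, y v ≤ ∑ v ∈ U, x v + 1

/-- Two vectors are compatible if their upper partial sums differ by at most `1`, all in the same
direction. -/
def Compatible (x y : V → ℝ) : Prop := UnitStep x y ∨ UnitStep y x

/-- The upper partial sums of a vector. -/
def upperSums (x : V → ℝ) (U : {U : Finset V // IsUpperSet (U : Set V)}) : ℝ := ∑ v ∈ U.1, x v

theorem UnitStep.le {x y : V → ℝ} (h : UnitStep x y) : upperSums x ≤ upperSums y :=
  fun U => (h U.1 U.2).1

variable [Fintype V]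

theorem isUpperSet_coe_univ : IsUpperSet ((Finset.univ : Finset V) : Set V) := by
  simp [isUpperSet_univ]

theorem isUpperSet_filter_le (v : V) :
    IsUpperSet ((Finset.univ.filter (v ≤ ·) : Finset V) : Set V) := by
  intro a b hab ha
  simp only [Finset.coe_filter, Finset.mem_univ, true_and, Set.mem_ofPred_eq] at ha ⊢
  exact ha.trans hab

theorem isUpperSet_filter_lt (v : V) :
    IsUpperSet ((Finset.univ.filter (v < ·) : Finset V) : Set V) := by
  intro a b hab ha
  simp only [Finset.coe_filter, Finset.mem_univ, true_and, Set.mem_ofPred_eq] at ha ⊢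
  exact ha.trans_le hab

theorem sum_filter_le_sub_sum_filter_lt (x : V → ℝ) (v : V) :
    ∑ u ∈ Finset.univ.filter (v ≤ ·), x u - ∑ u ∈ Finset.univ.filter (v < ·), x u = x v := by
  have : Finset.univ.filter (v ≤ ·) = insert v (Finset.univ.filter (v < ·)) := by
    ext u; simp [le_iff_eq_or_lt, eq_comm]
  rw [this, Finset.sum_insert (by simp)]
  ring

theorem le_ceil_of_mem_cell {x y : V → ℝ} (h : y ∈ cell x) (v : V) : y v ≤ ⌈x v⌉ := by
  have := h _ _ (isUpperSet_filter_le v) (isUpperSet_filter_lt v)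
  rwa [sum_filter_le_sub_sum_filter_lt, sum_filter_le_sub_sum_filter_lt] at this

theorem floor_apply_le_of_mem_cell {x y : V → ℝ} (h : y ∈ cell x) (v : V) : ⌊x v⌋ ≤ y v := by
  have := floor_le_of_mem_cell h (isUpperSet_filter_le v) (isUpperSet_filter_lt v)
  rwa [sum_filter_le_sub_sum_filter_lt, sum_filter_le_sub_sum_filter_lt] at this

theorem nonneg_of_mem_cell {x y : V → ℝ} (hx : ∀ v, 0 ≤ x v) (h : y ∈ cell x) (v : V) :
    0 ≤ y v :=
  (Int.cast_nonneg (Int.floor_nonneg.2 (hx v))).trans (floor_apply_le_of_mem_cell h v)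

theorem eq_zero_of_mem_cell {x y : V → ℝ} (h : y ∈ cell x) {v : V} (hv : x v = 0) : y v = 0 := by
  have h1 := floor_apply_le_of_mem_cell h v
  have h2 := le_ceil_of_mem_cell h v
  simp only [hv, Int.floor_zero, Int.ceil_zero, Int.cast_zero] at h1 h2
  exact le_antisymm h2 h1

theorem sum_eq_of_mem_cell {x y : V → ℝ} {c : ℕ} (hx : ∑ v, x v = c) (h : y ∈ cell x) :
    ∑ v, y v = c := by
  have h1 := floor_le_of_mem_cell h isUpperSet_coe_univ isUpperSet_coe_empty
  have h2 := h _ _ isUpperSet_coe_univ isUpperSet_coe_empty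
  simp only [hx, Finset.sum_empty, sub_zero, Int.floor_natCast, Int.ceil_natCast,
    Int.cast_natCast] at h1 h2
  exact le_antisymm h2 h1

theorem finite_integral_points_cell (x : V → ℝ) : {m | m ∈ cell x ∧ IsIntegral m}.Finite := by
  refine (finite_setOf_isIntegral_of_bounded (fun v => (⌊x v⌋ : ℝ))
    (fun v => (⌈x v⌉ : ℝ))).subset ?_
  rintro m ⟨hm, hi⟩
  exact ⟨hi, fun v => ⟨floor_apply_le_of_mem_cell hm v, le_ceil_of_mem_cell hm v⟩⟩

/-- Let D be the difference of the upper sums of two points of the cell. Since floor and ceiling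
differ by at most 1, D(U) - D(W) ≤ 1 for all U, W. Taking one set empty bounds |D| by 1; and if D is
positive somewhere, it is at least 1 there by integrality, so it is negative nowhere. -/
theorem compatible_of_mem_cell {x m m' : V → ℝ} (hm : m ∈ cell x)
    (hm' : m' ∈ cell x) (hi : IsIntegral m) (hi' : IsIntegral m') : Compatible m m' := by
  have key : ∀ U W : Finset V, IsUpperSet (U : Set V) → IsUpperSet (W : Set V) → ∀ p q : V → ℝ,
      p ∈ cell x → q ∈ cell x →
      (∑ v ∈ U, p v - ∑ v ∈ U, q v) - (∑ v ∈ W, p v - ∑ v ∈ W, q v) ≤ 1 := by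
    intro U W hU hW p q hp hq
    have h1 := hp U W hU hW
    have h2 := floor_le_of_mem_cell hq hU hW
    have h3 := Int.ceil_le_floor_add_one (∑ v ∈ U, x v - ∑ v ∈ W, x v)
    have h4 : (⌈∑ v ∈ U, x v - ∑ v ∈ W, x v⌉ : ℝ) ≤ ⌊∑ v ∈ U, x v - ∑ v ∈ W, x v⌋ + 1 := by
      exact_mod_cast h3
    linarith
  have e0 : ∀ p q : V → ℝ, ∑ v ∈ (∅ : Finset V), p v - ∑ v ∈ (∅ : Finset V), q v = 0 := by simp
  by_cases h : ∀ U : Finset V, IsUpperSet (U : Set V) → ∑ v ∈ U, m v ≤ ∑ v ∈ U, m' v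
  · left
    intro U hU
    refine ⟨h U hU, ?_⟩
    have := key U ∅ hU isUpperSet_coe_empty m' m hm' hm
    rw [e0] at this
    linarith
  · right
    push Not at h
    obtain ⟨W, hW, hlt⟩ := h
    have hge : 1 ≤ ∑ v ∈ W, m v - ∑ v ∈ W, m' v := by
      obtain ⟨k, hk⟩ := hi.exists_sum_eq W
      obtain ⟨l, hl⟩ := hi'.exists_sum_eq W
      rw [hk, hl] at hlt ⊢
      have : l < k := by exact_mod_cast hlt
      have : (1 : ℤ) ≤ k - l := by omega
      exact_mod_cast this
    intro U hU
    have h1 := key U ∅ hU isUpperSet_coe_empty m m' hm hm'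
    have h2 := key W U hW hU m m' hm hm'
    rw [e0] at h1
    constructor <;> linarith

theorem upperSums_injective : Function.Injective (upperSums : (V → ℝ) → _) := by
  intro x y h
  ext v
  rw [← sum_filter_le_sub_sum_filter_lt x, ← sum_filter_le_sub_sum_filter_lt y]
  have h1 := congrFun h ⟨_, isUpperSet_filter_le v⟩
  have h2 := congrFun h ⟨_, isUpperSet_filter_lt v⟩
  simp only [upperSums] at h1 h2
  rw [h1, h2]

theorem UnitStep.exists_sum_eq_add_one {x y : V → ℝ} (h : UnitStep x y) (hne : x ≠ y)
    (hx : IsIntegral x) (hy : IsIntegral y) :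
    ∃ U : Finset V, IsUpperSet (U : Set V) ∧ ∑ v ∈ U, y v = ∑ v ∈ U, x v + 1 := by
  by_contra hcon
  push Not at hcon
  refine hne (upperSums_injective (funext fun U => ?_))
  have h1 := h U.1 U.2
  have h2 := hcon U.1 U.2
  simp only [upperSums]
  obtain ⟨k, hk⟩ := hx.exists_sum_eq U.1
  obtain ⟨l, hl⟩ := hy.exists_sum_eq U.1
  rw [hk, hl] at h1 h2 ⊢
  have h3 : k ≤ l := by exact_mod_cast h1.1
  have h4 : l ≤ k + 1 := by exact_mod_cast h1.2
  have h5 : l ≠ k + 1 := by exact_mod_cast h2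
  have : k = l := by omega
  rw [this]

/-- In a chain of compatible integral vectors, there is an upper partial sum that is constant on
the members strictly below a given one, and constant on the other ones. -/
theorem exists_sum_eq_below {S : Finset (V → ℝ)} (hi : ∀ m ∈ S, IsIntegral m)
    (hc : ∀ m ∈ S, ∀ m' ∈ S, Compatible m m') {m : V → ℝ} (hm : m ∈ S) :
    ∃ U : Finset V, IsUpperSet (U : Set V) ∧
      (∀ m' ∈ S, upperSums m' < upperSums m → ∑ v ∈ U, m' v = ∑ v ∈ U, m v - 1) ∧
      ∀ m' ∈ S, ¬ upperSums m' < upperSums m → ∑ v ∈ U, m' v = ∑ v ∈ U, m v := by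
  classical
  by_cases hD : (S.filter fun m' => upperSums m' < upperSums m).Nonempty
  -- Here b is the immediate predecessor of m. An upper sum that jumps by 1 from b to m has used up
  -- the whole variation allowed by compatibility, so it is constant up to b and constant from m on.
  · obtain ⟨b, hb⟩ := (S.filter fun m' => upperSums m' < upperSums m).exists_maximalFor upperSums hD
    obtain ⟨hbS, hbm⟩ := Finset.mem_filter.1 hb.1
    have hstep : UnitStep b m := by
      rcases hc b hbS m hm with h | h
      · exact h
      · exact absurd hbm h.le.not_gt
    obtain ⟨U, hU, hUeq⟩ :=
      hstep.exists_sum_eq_add_one (fun h => by simp [h] at hbm) (hi b hbS) (hi m hm)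
    refine ⟨U, hU, fun m' hm' hlt => ?_, fun m' hm' hlt => ?_⟩
    · have h1 : upperSums m' ≤ upperSums b := by
        rcases hc m' hm' b hbS with h | h
        · exact h.le
        · exact hb.2 (Finset.mem_filter.2 ⟨hm', hlt⟩) h.le
      have h2 : UnitStep m' m := by
        rcases hc m' hm' m hm with h | h
        · exact h
        · exact absurd hlt h.le.not_gt
      have h3 := h1 ⟨U, hU⟩
      have h4 := (h2 U hU).2
      simp only [upperSums] at h3
      linarith
    · have h2 : UnitStep m m' := by
        rcases hc m hm m' hm' with h | h
        · exact h
        · have : upperSums m' = upperSums m := by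
            by_contra hne
            exact hlt (lt_of_le_of_ne h.le hne)
          rw [upperSums_injective this] at h ⊢
          exact h
      have h3 : UnitStep b m' := by
        rcases hc b hbS m' hm' with h | h
        · exact h
        · exact absurd (h2.le.trans h.le) hbm.not_ge
      have h4 := (h2 U hU).1
      have h5 := (h3 U hU).2
      linarith
  · refine ⟨∅, isUpperSet_coe_empty, fun m' hm' hlt => ?_, fun m' _ _ => by simp⟩
    exact absurd ⟨m', Finset.mem_filter.2 ⟨hm', hlt⟩⟩ hD

theorem Compatible.lt_or_eq_or_lt {x y : V → ℝ} (h : Compatible x y) :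
    upperSums x < upperSums y ∨ x = y ∨ upperSums y < upperSums x := by
  rcases h with h | h
  · rcases h.le.lt_or_eq with h | h
    · exact Or.inl h
    · exact Or.inr (Or.inl (upperSums_injective h))
  · rcases h.le.lt_or_eq with h | h
    · exact Or.inr (Or.inr h)
    · exact Or.inr (Or.inl (upperSums_injective h.symm))

/-- A set of compatible integral vectors is the vertex set of a simplex: for every vertex `m`
there is a difference of upper partial sums which is constant on the opposite facet, with value
one less than at `m`. -/
theorem exists_facet_functional {S : Finset (V → ℝ)} (hi : ∀ m ∈ S, IsIntegral m)
    (hc : ∀ m ∈ S, ∀ m' ∈ S, Compatible m m') {m : V → ℝ} (hm : m ∈ S) :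
    ∃ U W : Finset V, IsUpperSet (U : Set V) ∧ IsUpperSet (W : Set V) ∧
      ∀ m' ∈ S, m' ≠ m →
        ∑ v ∈ U, m' v - ∑ v ∈ W, m' v = ∑ v ∈ U, m v - ∑ v ∈ W, m v - 1 := by
  classical
  obtain ⟨U, hU, hU1, hU2⟩ := exists_sum_eq_below hi hc hm
  have hup : ∃ W : Finset V, IsUpperSet (W : Set V) ∧
      (∀ m' ∈ S, upperSums m < upperSums m' → ∑ v ∈ W, m' v = ∑ v ∈ W, m v + 1) ∧
      ∀ m' ∈ S, ¬ upperSums m < upperSums m' → ∑ v ∈ W, m' v = ∑ v ∈ W, m v := by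
    by_cases hD : (S.filter fun m' => upperSums m < upperSums m').Nonempty
    · obtain ⟨b, hb⟩ :=
        (S.filter fun m' => upperSums m < upperSums m').exists_minimalFor upperSums hD
      obtain ⟨hbS, hbm⟩ := Finset.mem_filter.1 hb.1
      -- With b the immediate successor of m, the jump below b separates the members above m from m
      -- and those below it. Subtracting this W-sum from the U-sum makes the value fall by 1 on both
      -- sides of m.
      obtain ⟨W, hW, hW1, hW2⟩ := exists_sum_eq_below hi hc hbS
      have hmb := hW1 m hm hbm
      refine ⟨W, hW, fun m' hm' hlt => ?_, fun m' hm' hlt => ?_⟩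
      · rw [hW2 m' hm' fun h =>
          absurd (hb.2 (Finset.mem_filter.2 ⟨hm', hlt⟩) h.le) h.not_ge, hmb]
        ring
      · rw [hW1 m' hm' ?_, hmb]
        rcases (hc m hm m' hm').lt_or_eq_or_lt with h | h | h
        · exact absurd h hlt
        · exact h ▸ hbm
        · exact h.trans hbm
    · refine ⟨∅, isUpperSet_coe_empty, fun m' hm' hlt => ?_, fun m' _ _ => by simp⟩
      exact absurd ⟨m', Finset.mem_filter.2 ⟨hm', hlt⟩⟩ hD
  obtain ⟨W, hW, hW1, hW2⟩ := hup
  refine ⟨U, W, hU, hW, fun m' hm' hne => ?_⟩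
  rcases (hc m' hm' m hm).lt_or_eq_or_lt with h | h | h
  · rw [hU1 m' hm' h, hW2 m' hm' h.not_gt]; ring
  · exact absurd h hne
  · rw [hU2 m' hm' h.not_gt, hW1 m' hm' h]; ring

/-- The coefficients of a combination of compatible integral vectors, in terms of upper partial
sums of the combination. -/
theorem exists_coefficient_formula {S : Finset (V → ℝ)} (hi : ∀ m ∈ S, IsIntegral m)
    (hc : ∀ m ∈ S, ∀ m' ∈ S, Compatible m m') {m : V → ℝ} (hm : m ∈ S) :
    ∃ U W : Finset V, IsUpperSet (U : Set V) ∧ IsUpperSet (W : Set V) ∧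
      ∀ μ : (V → ℝ) → ℝ, μ m = ∑ v ∈ U, (∑ m' ∈ S, μ m' • m') v -
        ∑ v ∈ W, (∑ m' ∈ S, μ m' • m') v -
        (∑ v ∈ U, m v - ∑ v ∈ W, m v - 1) * ∑ m' ∈ S, μ m' := by
  classical
  obtain ⟨U, W, hU, hW, h⟩ := exists_facet_functional hi hc hm
  refine ⟨U, W, hU, hW, fun μ => ?_⟩
  have e : ∀ U : Finset V, ∑ v ∈ U, (∑ m' ∈ S, μ m' • m') v =
      ∑ m' ∈ S, μ m' * ∑ v ∈ U, m' v := by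
    intro U
    simp only [Finset.sum_apply, Pi.smul_apply, smul_eq_mul, Finset.mul_sum]
    exact Finset.sum_comm
  rw [e, e, Finset.mul_sum, ← Finset.sum_sub_distrib, ← Finset.sum_sub_distrib,
    Finset.sum_eq_single m]
  · ring
  · intro m' hm' hne
    have := h m' hm' hne
    rw [← mul_sub, this]
    ring
  · exact fun h => absurd hm h

end Cells

/-! ### Cells as convex hulls of their integral points. -/

section CellVertices

open MeasureTheory

variable {V : Type*} [LinearOrder V]

/-- A vertex with positive coefficient belongs to the cell of a convex combination. -/
theorem mem_cell_of_coefficient_pos {S : Finset (V → ℝ)} (hi : ∀ m ∈ S, IsIntegral m)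
    (hc : ∀ m ∈ S, ∀ m' ∈ S, Compatible m m') {μ : (V → ℝ) → ℝ} (h0 : ∀ m ∈ S, 0 ≤ μ m)
    (h1 : ∑ m ∈ S, μ m = 1) {m : V → ℝ} (hm : m ∈ S) (hpos : 0 < μ m) :
    m ∈ cell (∑ m' ∈ S, μ m' • m') := by
  intro U W hU hW
  have e : ∀ U : Finset V, ∑ v ∈ U, (∑ m' ∈ S, μ m' • m') v =
      ∑ m' ∈ S, μ m' * ∑ v ∈ U, m' v := by
    intro U
    simp only [Finset.sum_apply, Pi.smul_apply, smul_eq_mul, Finset.mul_sum]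
    exact Finset.sum_comm
  obtain ⟨k, hk⟩ := (hi m hm).exists_sum_eq U
  obtain ⟨l, hl⟩ := (hi m hm).exists_sum_eq W
  rw [hk, hl, ← Int.cast_sub, Int.cast_le, Int.le_ceil_iff]
  push_cast
  rw [← hk, ← hl, e, e, ← Finset.sum_sub_distrib]
  -- For an integer, being at most the ceiling means being less than the value plus 1. By
  -- compatibility every vertex has a difference of at least that of m minus 1, and m itself, with
  -- positive weight, makes the inequality strict.
  have hlt : ∑ m' ∈ S, μ m' * ((∑ v ∈ U, m v - ∑ v ∈ W, m v) - 1) <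
      ∑ m' ∈ S, (μ m' * ∑ v ∈ U, m' v - μ m' * ∑ v ∈ W, m' v) := by
    refine Finset.sum_lt_sum (fun m' hm' => ?_) ⟨m, hm, ?_⟩
    · rw [← mul_sub]
      refine mul_le_mul_of_nonneg_left ?_ (h0 m' hm')
      rcases hc m hm m' hm' with h | h
      · linarith [(h U hU).1, (h W hW).2]
      · linarith [(h U hU).2, (h W hW).1]
    · rw [← mul_sub]
      exact mul_lt_mul_of_pos_left (by linarith) hpos
  rwa [← Finset.sum_mul, h1, one_mul] at hlt

variable [Fintype V]

/-- An upper set is determined by its minimum a: it is {v ≥ a}, and removing a leaves {v > a}.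
Peeling off minima telescopes the sum. -/
theorem sum_sub_filter_lt_telescope (G : Finset V → ℝ) (U : Finset V)
    (hU : IsUpperSet (U : Set V)) :
    ∑ v ∈ U, (G (Finset.univ.filter (v ≤ ·)) - G (Finset.univ.filter (v < ·))) = G U - G ∅ := by
  induction h : U.card generalizing U with
  | zero => simp [Finset.card_eq_zero.1 h]
  | succ k ih =>
    have hne : U.Nonempty := Finset.card_pos.1 (by omega)
    set a := U.min' hne with ha
    have haU : a ∈ U := U.min'_mem hne
    have e1 : Finset.univ.filter (a ≤ ·) = U := by
      ext v
      simp only [Finset.mem_filter, Finset.mem_univ, true_and]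
      exact ⟨fun h => hU h haU, fun h => U.min'_le v h⟩
    have e2 : Finset.univ.filter (a < ·) = U.erase a := by
      ext v
      simp only [Finset.mem_filter, Finset.mem_univ, true_and, Finset.mem_erase]
      exact ⟨fun h => ⟨h.ne', hU h.le haU⟩, fun h => lt_of_le_of_ne (U.min'_le v h.2) h.1.symm⟩
    have h3 := ih (U.erase a) (e2 ▸ isUpperSet_filter_lt a)
      (by rw [Finset.card_erase_of_mem haU]; omega)
    rw [← Finset.add_sum_erase _ _ haU, h3, e1, e2]
    ring

/-- The integral vector whose upper partial sums are the upper partial sums of `x`, shifted by `θ`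
and rounded down. -/
noncomputable def roundDown (x : V → ℝ) (θ : ℝ) (v : V) : ℝ :=
  (⌊∑ u ∈ Finset.univ.filter (v ≤ ·), x u + θ⌋ : ℝ) - ⌊∑ u ∈ Finset.univ.filter (v < ·), x u + θ⌋

theorem sum_roundDown (x : V → ℝ) (θ : ℝ) {U : Finset V} (hU : IsUpperSet (U : Set V)) :
    ∑ v ∈ U, roundDown x θ v = (⌊∑ u ∈ U, x u + θ⌋ : ℝ) - ⌊θ⌋ := by
  have := sum_sub_filter_lt_telescope (fun U => (⌊∑ u ∈ U, x u + θ⌋ : ℝ)) U hU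
  simpa [roundDown] using this

theorem isIntegral_roundDown (x : V → ℝ) (θ : ℝ) : IsIntegral (roundDown x θ) :=
  fun _ => ⟨_, (Int.cast_sub _ _).symm⟩

/-- The same shift θ is used for all upper sums, so the terms ⌊θ⌋ cancel and monotonicity of the
floor bounds the differences. -/
theorem roundDown_mem_cell (x : V → ℝ) (θ : ℝ) : roundDown x θ ∈ cell x := by
  intro U W hU hW
  rw [sum_roundDown x θ hU, sum_roundDown x θ hW]
  have h : ⌊∑ u ∈ U, x u + θ⌋ ≤ ⌊∑ u ∈ W, x u + θ⌋ + ⌈∑ v ∈ U, x v - ∑ v ∈ W, x v⌉ := by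
    rw [← Int.floor_add_intCast]
    refine Int.floor_le_floor ?_
    linarith [Int.le_ceil (∑ v ∈ U, x v - ∑ v ∈ W, x v)]
  have h' : (⌊∑ u ∈ U, x u + θ⌋ : ℝ) ≤
      ⌊∑ u ∈ W, x u + θ⌋ + ⌈∑ v ∈ U, x v - ∑ v ∈ W, x v⌉ := by exact_mod_cast h
  linarith

theorem intervalIntegrable_floor_add (z a b : ℝ) :
    IntervalIntegrable (fun θ => (⌊z + θ⌋ : ℝ)) volume a b := by
  refine Monotone.intervalIntegrable fun s t hst => ?_
  exact_mod_cast Int.floor_le_floor (by linarith)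

/-- Write the floor as z + θ minus a fractional part; by periodicity the integral of the latter does
not depend on z. -/
theorem integral_floor_add (z : ℝ) :
    ∫ θ in (0 : ℝ)..1, (⌊z + θ⌋ : ℝ) = z := by
  have h1 : ∀ θ : ℝ, (⌊z + θ⌋ : ℝ) = z + θ - Int.fract (z + θ) := fun θ => by
    rw [Int.fract]; ring
  have hf : ∀ y : ℝ, ∫ θ in (0 : ℝ)..1, Int.fract (y + θ) = ∫ θ in (0 : ℝ)..1, Int.fract θ := by
    intro y
    rw [intervalIntegral.integral_comp_add_left (fun t => Int.fract t) y]
    have hp : Function.Periodic (Int.fract : ℝ → ℝ) 1 := Int.fract_periodic ℝ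
    have := hp.intervalIntegral_add_eq y 0
    simpa using this
  have hfi : IntervalIntegrable (fun θ => Int.fract (z + θ)) volume 0 1 := by
    have : (fun θ => Int.fract (z + θ)) = fun θ => (z + θ) - (⌊z + θ⌋ : ℝ) := by
      ext θ; rw [Int.fract]
    rw [this]
    exact (Continuous.intervalIntegrable (by fun_prop) _ _).sub (intervalIntegrable_floor_add z 0 1)
  have h0 : ∫ θ in (0 : ℝ)..1, Int.fract θ = ∫ θ in (0 : ℝ)..1, θ := by
    refine intervalIntegral.integral_congr_ae ?_
    have : ∀ᵐ t : ℝ ∂volume, t ≠ 1 := by simp [ae_iff]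
    filter_upwards [this] with t ht hmem
    rw [Set.uIoc_of_le zero_le_one] at hmem
    exact Int.fract_eq_self.2 ⟨hmem.1.le, lt_of_le_of_ne hmem.2 ht⟩
  simp_rw [h1]
  rw [intervalIntegral.integral_sub (Continuous.intervalIntegrable (by fun_prop) _ _) hfi, hf, h0,
    ← intervalIntegral.integral_sub (Continuous.intervalIntegrable (by fun_prop) _ _)
      (Continuous.intervalIntegrable (by fun_prop) _ _)]
  simp

/-- x is the average of its roundings over θ, and the hull of the finitely many integral points of
the cell is closed and convex, so it contains averages of its points. -/
theorem mem_convexHull_integral_points_cell (x : V → ℝ) :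
    x ∈ convexHull ℝ {m | m ∈ cell x ∧ IsIntegral m} := by
  have hint : ∀ v, IntervalIntegrable (fun θ => roundDown x θ v) volume 0 1 := fun v =>
    (intervalIntegrable_floor_add _ 0 1).sub (intervalIntegrable_floor_add _ 0 1)
  have hprob : IsProbabilityMeasure (volume.restrict (Set.Ioc (0 : ℝ) 1)) := ⟨by simp⟩
  have hint' : Integrable (roundDown x) (volume.restrict (Set.Ioc (0 : ℝ) 1)) :=
    Integrable.of_eval fun v =>
      (intervalIntegrable_iff_integrableOn_Ioc_of_le zero_le_one).1 (hint v)
  have hmem := (convex_convexHull ℝ {m | m ∈ cell x ∧ IsIntegral m}).integral_mem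
    (μ := volume.restrict (Set.Ioc (0 : ℝ) 1))
    ((finite_integral_points_cell x).isCompact_convexHull (𝕜 := ℝ)).isClosed
    (f := roundDown x) (Filter.Eventually.of_forall fun θ => subset_convexHull ℝ _
      ⟨roundDown_mem_cell x θ, isIntegral_roundDown x θ⟩) hint'
  convert hmem
  ext v
  rw [eval_integral (fun v => Integrable.eval hint' v),
    ← intervalIntegral.integral_of_le zero_le_one]
  simp only [roundDown]
  rw [intervalIntegral.integral_sub (intervalIntegrable_floor_add _ 0 1)
    (intervalIntegrable_floor_add _ 0 1), integral_floor_add, integral_floor_add,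
    sum_filter_le_sub_sum_filter_lt]

theorem cell_eq_convexHull (x : V → ℝ) :
    cell x = convexHull ℝ {m | m ∈ cell x ∧ IsIntegral m} := by
  refine Set.Subset.antisymm (fun y hy => ?_) (convexHull_min (fun m hm => hm.1) (convex_cell x))
  exact convexHull_mono (fun m (hm : m ∈ cell y ∧ IsIntegral m) =>
    (⟨cell_subset_cell hy hm.1, hm.2⟩ : m ∈ cell x ∧ IsIntegral m))
    (mem_convexHull_integral_points_cell y)

/-- The vertices of the cell of a point of a simplex with compatible integral vertices are the
vertices whose barycentric coordinate is positive. -/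
theorem integral_points_cell_eq {S : Finset (V → ℝ)} (hi : ∀ m ∈ S, IsIntegral m)
    (hc : ∀ m ∈ S, ∀ m' ∈ S, Compatible m m') {μ : (V → ℝ) → ℝ} (h0 : ∀ m ∈ S, 0 ≤ μ m)
    (h1 : ∑ m ∈ S, μ m = 1) :
    {m | m ∈ cell (∑ m' ∈ S, μ m' • m') ∧ IsIntegral m} = {m | m ∈ S ∧ 0 < μ m} := by
  classical
  set x := ∑ m' ∈ S, μ m' • m' with hx
  refine Set.Subset.antisymm ?_ fun m (hm : m ∈ S ∧ 0 < μ m) =>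
    ⟨mem_cell_of_coefficient_pos hi hc h0 h1 hm.1 hm.2, hi m hm.1⟩
  have hfin := finite_integral_points_cell x
  have hM : ∀ m, m ∈ hfin.toFinset ↔ m ∈ cell x ∧ IsIntegral m := fun m => hfin.mem_toFinset
  set ν : (V → ℝ) → ℝ := fun m => if m ∈ S then μ m else 0 with hν
  -- Values in a product let one statement transfer both the total weight and the weighted sum from
  -- S to the integral points of the cell.
  have hsub : ∀ f : (V → ℝ) → ℝ → (V → ℝ) × ℝ, (∀ m, f m 0 = 0) →
      ∑ m ∈ hfin.toFinset, f m (ν m) = ∑ m ∈ S, f m (μ m) := by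
    intro f hf
    have hs1 : ∑ m ∈ S, f m (μ m) = ∑ m ∈ S.filter (fun m => 0 < μ m), f m (ν m) := by
      rw [Finset.sum_filter]
      refine Finset.sum_congr rfl fun m hm => ?_
      by_cases h : 0 < μ m
      · simp [h, hν, hm]
      · have : μ m = 0 := le_antisymm (not_lt.1 h) (h0 m hm)
        simp [this, hf]
    rw [hs1]
    symm
    refine Finset.sum_subset (fun m hm => ?_) fun m hm hnot => ?_
    · obtain ⟨hmS, hpos⟩ := Finset.mem_filter.1 hm
      exact (hM m).2 ⟨mem_cell_of_coefficient_pos hi hc h0 h1 hmS hpos, hi m hmS⟩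
    · have : ν m = 0 := by
        by_cases hmS : m ∈ S
        · have : ¬ 0 < μ m := fun h => hnot (Finset.mem_filter.2 ⟨hmS, h⟩)
          simp only [hν, hmS, if_true]
          exact le_antisymm (not_lt.1 this) (h0 m hmS)
        · simp [hν, hmS]
      rw [this, hf]
  rintro m ⟨hm, hmi⟩
  -- The integral points of the cell are compatible too, so the coefficient of m can be read off
  -- from x. It is positive because the difference at m is at most a ceiling, hence less than the
  -- difference at x plus 1.
  obtain ⟨U, W, hU, hW, h⟩ := exists_coefficient_formula (S := hfin.toFinset)
    (fun m hm => ((hM m).1 hm).2)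
    (fun m hm m' hm' => compatible_of_mem_cell ((hM m).1 hm).1 ((hM m').1 hm').1
      ((hM m).1 hm).2 ((hM m').1 hm').2) ((hM m).2 ⟨hm, hmi⟩)
  have h2 := h ν
  have hsum := hsub (fun m t => (t • m, t)) (by simp)
  have hν1 := congrArg Prod.snd hsum
  have hν2 := congrArg Prod.fst hsum
  simp only [Prod.snd_sum, Prod.fst_sum] at hν1 hν2
  rw [hν2, hν1, h1, ← hx] at h2
  have h3 : (∑ v ∈ U, m v - ∑ v ∈ W, m v) < ∑ v ∈ U, x v - ∑ v ∈ W, x v + 1 :=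
    (hm U W hU hW).trans_lt (Int.ceil_lt_add_one _)
  have h4 : 0 < ν m := by linarith
  by_cases hmS : m ∈ S
  · simp only [hν, hmS, if_true] at h4
    exact ⟨hmS, h4⟩
  · simp [hν, hmS] at h4

end CellVertices

/-! ### Affinely independent sets and affine interpolation. -/

section AffineIndependence

theorem affineIndependent_finset_iff {E : Type*} [AddCommGroup E] [Module ℝ E] {s : Finset E} :
    AffineIndependent ℝ ((↑) : s → E) ↔
      ∀ w : E → ℝ, ∑ v ∈ s, w v = 0 → ∑ v ∈ s, w v • v = 0 → ∀ v ∈ s, w v = 0 := by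
  classical
  rw [affineIndependent_iff_of_fintype]
  have key : ∀ w : s → ℝ, ∑ i, w i = 0 →
      Finset.univ.weightedVSub ((↑) : s → E) w = ∑ i, w i • (i : E) := fun w hw => by
    rw [Finset.weightedVSub_eq_weightedVSubOfPoint_of_sum_eq_zero _ _ _ hw (0 : E)]
    simp [Finset.weightedVSubOfPoint_apply]
  constructor
  · intro h w h0 h1 v hv
    have h0' : ∑ i : s, w i = 0 := by rw [Finset.sum_coe_sort s w, h0]
    refine h (fun i => w i) h0' ?_ ⟨v, hv⟩
    rw [key _ h0', Finset.sum_coe_sort s fun v => w v • v, h1]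
  · intro h w h0 h1 i
    rw [key w h0] at h1
    have := h (fun v => if hv : v ∈ s then w ⟨v, hv⟩ else 0) ?_ ?_ i i.2
    · simpa using this
    · rw [← Finset.sum_coe_sort]; simpa using h0
    · rw [← Finset.sum_coe_sort s fun v => (if hv : v ∈ s then w ⟨v, hv⟩ else 0) • v]
      simpa using h1

/-- Values on affinely independent points are interpolated by an affine function. -/
theorem exists_affine_interpolation {n : ℕ} {s : Finset (Fin n → ℝ)}
    (hs : AffineIndependent ℝ ((↑) : s → Fin n → ℝ)) (b : (Fin n → ℝ) → ℝ) :
    ∃ (η : Fin n → ℝ) (ζ : ℝ), ∀ v ∈ s, η ⬝ᵥ v + ζ = b v := by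
  classical
  -- Homogenizing turns affine into linear independence, so the values extend to a linear functional
  -- on ℝⁿ × ℝ.
  have hli : LinearIndependent ℝ (fun v : s => ((v : Fin n → ℝ), (1 : ℝ))) := by
    rw [Fintype.linearIndependent_iff]
    intro g hg i
    have h1 := congrArg Prod.fst hg
    have h2 := congrArg Prod.snd hg
    simp only [Prod.fst_sum, Prod.snd_sum, Prod.smul_fst, Prod.smul_snd, Prod.fst_zero,
      Prod.snd_zero, smul_eq_mul, mul_one] at h1 h2
    have := affineIndependent_finset_iff.1 hs (fun v => if hv : v ∈ s then g ⟨v, hv⟩ else 0)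
      ?_ ?_ i i.2
    · simpa using this
    · rw [← Finset.sum_coe_sort]; simpa using h2
    · rw [← Finset.sum_coe_sort s fun v => (if hv : v ∈ s then g ⟨v, hv⟩ else 0) • v]
      simpa using h1
  obtain ⟨f, hf⟩ := LinearMap.exists_extend
    ((Module.Basis.span hli).constr ℝ (fun v : s => b v))
  have hfv : ∀ v : s, f ((v : Fin n → ℝ), (1 : ℝ)) = b v := fun v => by
    have h := LinearMap.congr_fun hf ((Module.Basis.span hli) v)
    rw [Module.Basis.constr_basis] at h
    rw [← h, LinearMap.comp_apply, Submodule.subtype_apply, Module.Basis.span_apply]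
  refine ⟨fun i => f (Pi.single i 1, 0), f (0, 1), fun v hv => ?_⟩
  rw [← hfv ⟨v, hv⟩]
  have e : ((v, (1 : ℝ)) : (Fin n → ℝ) × ℝ) =
      ∑ i, v i • ((Pi.single i 1 : Fin n → ℝ), (0 : ℝ)) + (0, 1) := by
    refine Prod.ext ?_ ?_
    · simp only [Prod.fst_add, Prod.fst_sum, Prod.smul_fst, add_zero]
      exact pi_eq_sum_univ' v
    · simp [Prod.snd_sum]
  rw [e, map_add, map_sum]
  simp only [map_smul, smul_eq_mul, dotProduct]
  congr 1
  exact Finset.sum_congr rfl fun i _ => mul_comm _ _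

theorem dotProduct_combination {n : ℕ} {s : Finset (Fin n → ℝ)} {w : (Fin n → ℝ) → ℝ}
    (h1 : ∑ u ∈ s, w u = 1) (η : Fin n → ℝ) (ζ : ℝ) :
    η ⬝ᵥ (∑ u ∈ s, w u • u) + ζ = ∑ u ∈ s, w u * (η ⬝ᵥ u + ζ) := by
  simp only [dotProduct_sum, dotProduct_smul, smul_eq_mul, mul_add, Finset.sum_add_distrib,
    ← Finset.sum_mul, h1, one_mul]

/-- The vertices of a simplex belong to every set that spans it. -/
theorem subset_of_convexHull_eq {n : ℕ} {s : Finset (Fin n → ℝ)}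
    (hs : AffineIndependent ℝ ((↑) : s → Fin n → ℝ)) {A : Set (Fin n → ℝ)}
    (h : convexHull ℝ A = convexHull ℝ (s : Set (Fin n → ℝ))) : (s : Set (Fin n → ℝ)) ⊆ A := by
  classical
  intro v hv
  by_contra hvA
  -- This affine function is the barycentric coordinate of v. On the simplex it reaches 1 only at v,
  -- so an A avoiding v lies in the open half-space below 1, and so does its hull.
  obtain ⟨η, ζ, hη⟩ := exists_affine_interpolation hs (fun u => if u = v then 1 else 0)
  have hconv : Convex ℝ {p : Fin n → ℝ | η ⬝ᵥ p < 1 - ζ} :=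
    convex_halfSpace_lt ⟨dotProduct_add η, fun c x => dotProduct_smul c η x⟩ _
  have hsub : A ⊆ {p : Fin n → ℝ | η ⬝ᵥ p < 1 - ζ} := by
    intro a ha
    have ha' : a ∈ convexHull ℝ (s : Set (Fin n → ℝ)) := h ▸ subset_convexHull ℝ A ha
    obtain ⟨w, h0, h1, hwa⟩ := Finset.mem_convexHull'.1 ha'
    have hval : η ⬝ᵥ a + ζ = w v := by
      rw [← hwa, dotProduct_combination h1]
      calc ∑ u ∈ s, w u * (η ⬝ᵥ u + ζ) = ∑ u ∈ s, if u = v then w u else 0 :=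
            Finset.sum_congr rfl fun u hu => by
              rw [hη u hu]; split_ifs <;> simp
        _ = w v := by rw [Finset.sum_ite_eq' s v w, if_pos (Finset.mem_coe.1 hv)]
    have hle : w v ≤ 1 := h1 ▸ Finset.single_le_sum h0 hv
    have hne : w v ≠ 1 := by
      intro hw
      have hz : ∀ u ∈ s.erase v, w u = 0 := by
        rw [← Finset.sum_eq_zero_iff_of_nonneg fun u hu => h0 u (Finset.mem_of_mem_erase hu)]
        have := Finset.add_sum_erase s w hv
        linarith
      apply hvA
      have : a = v := by
        rw [← hwa, ← Finset.add_sum_erase s (fun u => w u • u) hv, hw, one_smul,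
          Finset.sum_eq_zero fun u hu => by rw [hz u hu, zero_smul], add_zero]
      exact this ▸ ha
    have : w v < 1 := lt_of_le_of_ne hle hne
    simp only [Set.mem_ofPred_eq]
    linarith
  have hv' : v ∈ convexHull ℝ A := h ▸ subset_convexHull ℝ _ hv
  have := convexHull_min hsub hconv hv'
  have hv1 := hη v hv
  simp only [Set.mem_ofPred_eq, if_true] at this hv1
  linarith

end AffineIndependence

/-! ### Coordinate vectors of points in dilated faces. -/

section Refinement

variable {n : ℕ} {V : Type*} [Fintype V]

/-- The linear map taking the unit vectors to the points `pos v`. -/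
noncomputable def proj (pos : V → Fin n → ℝ) : (V → ℝ) →ₗ[ℝ] Fin n → ℝ :=
  Fintype.linearCombination ℝ pos

theorem proj_apply (pos : V → Fin n → ℝ) (x : V → ℝ) : proj pos x = ∑ v, x v • pos v := by
  simp [proj, Fintype.linearCombination_apply]

/-- The coordinate vectors of the points of the `c`-fold dilation of the simplex with vertex set
`s`. -/
def dilatedFace (pos : V → Fin n → ℝ) (c : ℕ) (s : Set (Fin n → ℝ)) : Set (V → ℝ) :=
  {x | (∀ v, 0 ≤ x v) ∧ ∑ v, x v = c ∧ ∀ v, pos v ∉ s → x v = 0}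

theorem convex_dilatedFace (pos : V → Fin n → ℝ) (c : ℕ) (s : Set (Fin n → ℝ)) :
    Convex ℝ (dilatedFace pos c s) := by
  rintro x ⟨hx0, hx1, hx2⟩ y ⟨hy0, hy1, hy2⟩ a b ha hb hab
  refine ⟨fun v => ?_, ?_, fun v hv => ?_⟩
  · exact add_nonneg (mul_nonneg ha (hx0 v)) (mul_nonneg hb (hy0 v))
  · simp only [Pi.add_apply, Pi.smul_apply, smul_eq_mul, Finset.sum_add_distrib, ← Finset.mul_sum,
      hx1, hy1]
    rw [← add_mul, hab, one_mul]
  · simp [hx2 v hv, hy2 v hv]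

theorem dilatedFace_mono (pos : V → Fin n → ℝ) (c : ℕ) {s t : Set (Fin n → ℝ)} (h : s ⊆ t) :
    dilatedFace pos c s ⊆ dilatedFace pos c t :=
  fun _ hx => ⟨hx.1, hx.2.1, fun v hv => hx.2.2 v fun hs => hv (h hs)⟩

variable {T : SimplicialComplex ℝ (Fin n → ℝ)} {pos : V → Fin n → ℝ}

theorem convexHull_image_proj [DecidableEq (Fin n → ℝ)] (s : Finset (V → ℝ)) :
    convexHull ℝ ((s.image (proj pos) : Finset (Fin n → ℝ)) : Set (Fin n → ℝ)) =
      proj pos '' convexHull ℝ (s : Set (V → ℝ)) := by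
  rw [Finset.coe_image, LinearMap.image_convexHull]

theorem proj_mem_latticePoints (hpos : ∀ v, pos v ∈ latticePoints n) {m : V → ℝ}
    (hm : IsIntegral m) : proj pos m ∈ latticePoints n := by
  intro i
  have : IsIntegral fun v => m v * pos v i := fun v => by
    obtain ⟨k, hk⟩ := hm v
    obtain ⟨l, hl⟩ := hpos v i
    exact ⟨k * l, by push_cast; rw [hk, hl]⟩
  obtain ⟨k, hk⟩ := this.exists_sum_eq Finset.univ
  exact ⟨k, by rw [← hk, proj_apply, Finset.sum_apply]; rfl⟩

theorem dotProduct_proj {c : ℕ} {x : V → ℝ} (hx : ∑ v, x v = c) (η : Fin n → ℝ) (ζ : ℝ) :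
    η ⬝ᵥ proj pos x + c * ζ = ∑ v, x v * (η ⬝ᵥ pos v + ζ) := by
  rw [proj_apply]
  simp only [dotProduct_sum, dotProduct_smul, smul_eq_mul, mul_add, Finset.sum_add_distrib,
    ← Finset.sum_mul, hx]

theorem sum_face_eq [DecidableEq (Fin n → ℝ)] (hinj : Function.Injective pos)
    (hrange : Set.range pos = T.vertices)
    {σ : Finset (Fin n → ℝ)} (hσ : σ ∈ T.faces) {M : Type*} [AddCommMonoid M]
    (f : (Fin n → ℝ) → M) :
    ∑ p ∈ σ, f p = ∑ v, if pos v ∈ σ then f (pos v) else 0 := by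
  have : σ = (Finset.univ.filter fun v => pos v ∈ σ).image pos := by
    ext p
    simp only [Finset.mem_image, Finset.mem_filter, Finset.mem_univ, true_and]
    refine ⟨fun hp => ?_, ?_⟩
    · have : p ∈ Set.range pos := by
        rw [hrange]
        exact T.down_closed hσ (Finset.singleton_subset_iff.2 hp) (Finset.singleton_nonempty p)
      obtain ⟨v, rfl⟩ := this
      exact ⟨v, hp, rfl⟩
    · rintro ⟨v, hv, rfl⟩
      exact hv
  conv_lhs => rw [this]
  rw [Finset.sum_image fun a _ b _ h => hinj h, Finset.sum_filter]

/-- Coordinates with respect to the vertices of a face are unique. -/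
theorem eq_of_proj_eq (hinj : Function.Injective pos) (hrange : Set.range pos = T.vertices)
    {σ : Finset (Fin n → ℝ)} (hσ : σ ∈ T.faces) {x y : V → ℝ}
    (hx : ∀ v, pos v ∉ σ → x v = 0) (hy : ∀ v, pos v ∉ σ → y v = 0)
    (hsum : ∑ v, x v = ∑ v, y v) (h : proj pos x = proj pos y) : x = y := by
  classical
  have hw : ∀ v, Function.extend pos (x - y) 0 (pos v) = x v - y v := fun v => by
    rw [hinj.extend_apply]; rfl
  have key := affineIndependent_finset_iff.1 (T.indep hσ) (Function.extend pos (x - y) 0) ?_ ?_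
  · ext v
    by_cases hv : pos v ∈ σ
    · have := key _ hv
      rw [hw] at this
      linarith
    · rw [hx v hv, hy v hv]
  · rw [sum_face_eq hinj hrange hσ]
    simp_rw [hw]
    rw [← sub_eq_zero, ← Finset.sum_sub_distrib] at hsum
    refine Eq.trans ?_ hsum
    refine Finset.sum_congr rfl fun v _ => ?_
    split_ifs with hv
    · rfl
    · rw [hx v hv, hy v hv, sub_zero]
  · rw [sum_face_eq hinj hrange hσ]
    simp_rw [hw]
    rw [← sub_eq_zero, ← map_sub, proj_apply] at h
    refine Eq.trans ?_ h
    refine Finset.sum_congr rfl fun v _ => ?_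
    split_ifs with hv
    · rfl
    · rw [Pi.sub_apply, hx v hv, hy v hv, sub_zero, zero_smul]

theorem proj_image_dilatedFace (hinj : Function.Injective pos)
    (hrange : Set.range pos = T.vertices) {σ : Finset (Fin n → ℝ)} (hσ : σ ∈ T.faces)
    {c : ℕ} (hc : 0 < c) :
    proj pos '' dilatedFace pos c σ = (c : ℝ) • convexHull ℝ (σ : Set (Fin n → ℝ)) := by
  classical
  have hc' : (c : ℝ) ≠ 0 := by exact_mod_cast hc.ne'
  ext p
  constructor
  · rintro ⟨x, ⟨h0, h1, h2⟩, rfl⟩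
    refine ⟨(c : ℝ)⁻¹ • proj pos x, ?_, smul_inv_smul₀ hc' _⟩
    refine Finset.mem_convexHull'.2 ⟨fun p => (c : ℝ)⁻¹ * Function.extend pos x 0 p, ?_, ?_, ?_⟩
    · intro p hp
      refine mul_nonneg (by positivity) ?_
      by_cases h : ∃ v, pos v = p
      · obtain ⟨v, rfl⟩ := h
        rw [hinj.extend_apply]; exact h0 v
      · rw [Function.extend_apply' _ _ _ h]; rfl
    · rw [← Finset.mul_sum, sum_face_eq hinj hrange hσ, inv_mul_eq_one₀ hc', ← h1]
      refine Finset.sum_congr rfl fun v _ => ?_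
      rw [hinj.extend_apply]
      split_ifs with hv
      · rfl
      · exact h2 v hv
    · simp_rw [mul_smul]
      rw [← Finset.smul_sum, sum_face_eq hinj hrange hσ, proj_apply]
      congr 1
      refine Finset.sum_congr rfl fun v _ => ?_
      rw [hinj.extend_apply]
      split_ifs with hv
      · rfl
      · rw [h2 v hv, zero_smul]
  · rintro ⟨q, hq, rfl⟩
    obtain ⟨w, h0, h1, rfl⟩ := Finset.mem_convexHull'.1 hq
    refine ⟨fun v => if pos v ∈ σ then c * w (pos v) else 0, ⟨fun v => ?_, ?_, fun v hv => ?_⟩, ?_⟩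
    · dsimp only
      split_ifs with hv
      · exact mul_nonneg (by positivity) (h0 _ hv)
      · rfl
    · rw [← sum_face_eq hinj hrange hσ fun p => c * w p, ← Finset.mul_sum, h1, mul_one]
    · exact if_neg hv
    · change _ = (c : ℝ) • _
      rw [proj_apply, Finset.smul_sum, sum_face_eq hinj hrange hσ]
      refine Finset.sum_congr rfl fun v _ => ?_
      split_ifs with hv
      · rw [mul_smul]
      · rw [zero_smul]

/-- The coordinate vectors of the points of a dilated triangulation are unique. -/
theorem eq_of_mem_dilatedFace (hinj : Function.Injective pos) (hrange : Set.range pos = T.vertices)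
    {c : ℕ} (hc : 0 < c) {σ τ : Finset (Fin n → ℝ)} (hσ : σ ∈ T.faces) (hτ : τ ∈ T.faces)
    {x y : V → ℝ} (hx : x ∈ dilatedFace pos c σ) (hy : y ∈ dilatedFace pos c τ)
    (h : proj pos x = proj pos y) : x = y := by
  classical
  have hc' : (c : ℝ) ≠ 0 := by exact_mod_cast hc.ne'
  have h1 : proj pos x ∈ (c : ℝ) • convexHull ℝ (σ : Set (Fin n → ℝ)) :=
    proj_image_dilatedFace hinj hrange hσ hc ▸ Set.mem_image_of_mem _ hx
  have h2 : proj pos x ∈ (c : ℝ) • convexHull ℝ (τ : Set (Fin n → ℝ)) := by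
    rw [h]
    exact proj_image_dilatedFace hinj hrange hτ hc ▸ Set.mem_image_of_mem _ hy
  rw [Set.mem_smul_set_iff_inv_smul_mem₀ hc'] at h1 h2
  -- The common point has coordinates z on the face σ ∩ τ; uniqueness within σ and within τ
  -- identifies z with both x and y.
  have h3 := T.inter_subset_convexHull hσ hτ ⟨h1, h2⟩
  rw [← Finset.coe_inter] at h3
  have hne : (σ ∩ τ).Nonempty := by
    rw [← Finset.coe_nonempty, ← convexHull_nonempty_iff (𝕜 := ℝ)]
    exact ⟨_, h3⟩
  have hστ := T.down_closed hσ Finset.inter_subset_left hne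
  rw [← Set.mem_smul_set_iff_inv_smul_mem₀ hc', ← proj_image_dilatedFace hinj hrange hστ hc] at h3
  obtain ⟨z, hz, hzx⟩ := h3
  have hzσ := dilatedFace_mono pos c (Finset.coe_subset.2 Finset.inter_subset_left) hz
  have hzτ := dilatedFace_mono pos c (Finset.coe_subset.2 Finset.inter_subset_right) hz
  have e1 : z = x := eq_of_proj_eq hinj hrange hσ hzσ.2.2 hx.2.2 (hz.2.1.trans hx.2.1.symm) hzx
  have e2 : z = y := eq_of_proj_eq hinj hrange hτ hzτ.2.2 hy.2.2 (hz.2.1.trans hy.2.1.symm)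
    (hzx.trans h)
  exact e1.symm.trans e2

end Refinement

/-! ### The refined simplicial complex. -/

section RefinedComplex

variable {n : ℕ} {V : Type*} [LinearOrder V] [Fintype V]

/-- A set of coordinate vectors of the vertices of a face of the canonical refinement of the
`c`-fold dilation of `T`. -/
structure IsRefinedFace (T : SimplicialComplex ℝ (Fin n → ℝ)) (pos : V → Fin n → ℝ) (c : ℕ)
    (s : Finset (V → ℝ)) : Prop where
  nonempty : s.Nonempty
  integral : ∀ m ∈ s, IsIntegral m
  compatible : ∀ m ∈ s, ∀ m' ∈ s, Compatible m m'
  supported : ∃ σ ∈ T.faces, (s : Set (V → ℝ)) ⊆ dilatedFace pos c σ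

variable {T : SimplicialComplex ℝ (Fin n → ℝ)} {pos : V → Fin n → ℝ} {c : ℕ}

theorem cell_subset_dilatedFace {σ : Set (Fin n → ℝ)} {x : V → ℝ}
    (hx : x ∈ dilatedFace pos c σ) : cell x ⊆ dilatedFace pos c σ :=
  fun _ hy => ⟨nonneg_of_mem_cell hx.1 hy, sum_eq_of_mem_cell hx.2.1 hy,
    fun v hv => eq_zero_of_mem_cell hy (hx.2.2 v hv)⟩

theorem IsRefinedFace.mono {s t : Finset (V → ℝ)} (hs : IsRefinedFace T pos c s) (h : t ⊆ s)
    (ht : t.Nonempty) : IsRefinedFace T pos c t where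
  nonempty := ht
  integral m hm := hs.integral m (h hm)
  compatible m hm m' hm' := hs.compatible m (h hm) m' (h hm')
  supported := by
    obtain ⟨σ, hσ, hsσ⟩ := hs.supported
    exact ⟨σ, hσ, (Finset.coe_subset.2 h).trans hsσ⟩

theorem IsRefinedFace.injOn (hinj : Function.Injective pos) (hrange : Set.range pos = T.vertices)
    {s : Finset (V → ℝ)} (hs : IsRefinedFace T pos c s) :
    Set.InjOn (proj pos) (s : Set (V → ℝ)) := by
  obtain ⟨σ, hσ, hsσ⟩ := hs.supported
  exact fun x hx y hy h => eq_of_proj_eq hinj hrange hσ (hsσ hx).2.2 (hsσ hy).2.2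
    ((hsσ hx).2.1.trans (hsσ hy).2.1.symm) h

theorem sum_smul_image_proj [DecidableEq (Fin n → ℝ)] (hinj : Function.Injective pos)
    (hrange : Set.range pos = T.vertices)
    {s : Finset (V → ℝ)} (hs : IsRefinedFace T pos c s) (w : (Fin n → ℝ) → ℝ) :
    ∑ p ∈ s.image (proj pos), w p • p = proj pos (∑ m ∈ s, w (proj pos m) • m) := by
  rw [Finset.sum_image (hs.injOn hinj hrange), map_sum]
  simp only [map_smul]

/-- An affine dependence lifts to a dependence in ℝ^V, all vertices being supported on one face of
`T`; the coefficient formula then expresses each weight through the zero vector and the zero total.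
-/
theorem IsRefinedFace.affineIndependent [DecidableEq (Fin n → ℝ)] (hinj : Function.Injective pos)
    (hrange : Set.range pos = T.vertices)
    {s : Finset (V → ℝ)} (hs : IsRefinedFace T pos c s) :
    AffineIndependent ℝ ((↑) : s.image (proj pos) → Fin n → ℝ) := by
  rw [affineIndependent_finset_iff]
  intro w h0 h1 p hp
  obtain ⟨m, hm, rfl⟩ := Finset.mem_image.1 hp
  rw [sum_smul_image_proj hinj hrange hs] at h1
  rw [Finset.sum_image (hs.injOn hinj hrange)] at h0
  obtain ⟨σ, hσ, hsσ⟩ := hs.supported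
  have hx : ∑ m ∈ s, w (proj pos m) • m = 0 := by
    refine eq_of_proj_eq hinj hrange hσ (fun v hv => ?_) (fun _ _ => rfl) ?_ (by rw [h1, map_zero])
    · rw [Finset.sum_apply]
      exact Finset.sum_eq_zero fun m hm => by simp [(hsσ hm).2.2 v hv]
    · simp only [Finset.sum_apply, Pi.smul_apply, smul_eq_mul, Pi.zero_apply, Finset.sum_const_zero]
      rw [Finset.sum_comm]
      simp_rw [← Finset.mul_sum]
      rw [Finset.sum_congr rfl fun m hm => by rw [(hsσ hm).2.1], ← Finset.sum_mul, h0, zero_mul]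
  obtain ⟨U, W, -, -, h⟩ := exists_coefficient_formula hs.integral hs.compatible hm
  rw [h fun m => w (proj pos m), hx, h0]
  simp

theorem exists_isRefinedFace_cell {σ : Finset (Fin n → ℝ)}
    (hσ : σ ∈ T.faces) {x : V → ℝ} (hx : x ∈ dilatedFace pos c σ) :
    ∃ s : Finset (V → ℝ), IsRefinedFace T pos c s ∧ (s : Set (V → ℝ)) ⊆ dilatedFace pos c σ ∧
      cell x = convexHull ℝ (s : Set (V → ℝ)) := by
  have hfin := finite_integral_points_cell x
  have hM : ∀ m, m ∈ hfin.toFinset ↔ m ∈ cell x ∧ IsIntegral m := fun m => hfin.mem_toFinset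
  have hsub : (hfin.toFinset : Set (V → ℝ)) ⊆ dilatedFace pos c σ :=
    fun m hm => cell_subset_dilatedFace hx ((hM m).1 hm).1
  have hcell : cell x = convexHull ℝ (hfin.toFinset : Set (V → ℝ)) := by
    rw [hfin.coe_toFinset]; exact cell_eq_convexHull x
  refine ⟨hfin.toFinset, ⟨?_, fun m hm => ((hM m).1 hm).2, fun m hm m' hm' => ?_, σ, hσ, hsub⟩,
    hsub, hcell⟩
  · rw [← Finset.coe_nonempty, ← convexHull_nonempty_iff (𝕜 := ℝ), ← hcell]
    exact ⟨x, mem_cell_self x⟩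
  · exact compatible_of_mem_cell ((hM m).1 hm).1 ((hM m').1 hm').1 ((hM m).1 hm).2 ((hM m').1 hm').2

/-- The face spanned by a refined face is the cell of its barycenter. -/
theorem IsRefinedFace.exists_cell_eq {s : Finset (V → ℝ)} (hs : IsRefinedFace T pos c s)
    {σ : Set (Fin n → ℝ)} (hsσ : (s : Set (V → ℝ)) ⊆ dilatedFace pos c σ) :
    ∃ x ∈ dilatedFace pos c σ, cell x = convexHull ℝ (s : Set (V → ℝ)) := by
  have hcard : (0 : ℝ) < s.card := by exact_mod_cast hs.nonempty.card_pos
  have h0 : ∀ m ∈ s, (0 : ℝ) ≤ (fun _ : V → ℝ => (s.card : ℝ)⁻¹) m := fun m _ => by positivity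
  have h1 : ∑ m ∈ s, (fun _ : V → ℝ => (s.card : ℝ)⁻¹) m = 1 := by
    rw [Finset.sum_const, nsmul_eq_mul, mul_inv_cancel₀ hcard.ne']
  refine ⟨_, (convex_dilatedFace pos c σ).sum_mem h0 h1 fun m hm => hsσ hm, ?_⟩
  rw [cell_eq_convexHull, integral_points_cell_eq hs.integral hs.compatible h0 h1]
  congr 1
  ext m
  simp [hcard]

/-- The canonical refinement of the `c`-fold dilation of `T`. -/
noncomputable def refinedComplex (T : SimplicialComplex ℝ (Fin n → ℝ)) (pos : V → Fin n → ℝ)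
    (hinj : Function.Injective pos) (hrange : Set.range pos = T.vertices) (c : ℕ) (hc : 0 < c) :
    SimplicialComplex ℝ (Fin n → ℝ) where
  faces := open Classical in {t | ∃ s, IsRefinedFace T pos c s ∧ t = s.image (proj pos)}
  isRelLowerSet_faces := by
    classical
    rintro t ⟨s, hs, rfl⟩
    refine ⟨hs.nonempty.image _, fun u hu hne => ?_⟩
    obtain ⟨s', hs', rfl⟩ := Finset.subset_image_iff.1 hu
    exact ⟨s', hs.mono (Finset.coe_subset.1 hs') (Finset.image_nonempty.1 hne), by congr⟩
  indep := by
    classical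
    rintro t ⟨s, hs, rfl⟩
    convert hs.affineIndependent hinj hrange
  inter_subset_convexHull := by
    classical
    rintro t t' ⟨s, hs, rfl⟩ ⟨s', hs', rfl⟩ p ⟨hp, hp'⟩
    rw [convexHull_image_proj] at hp hp'
    obtain ⟨x, hx, rfl⟩ := hp
    obtain ⟨y, hy, hxy⟩ := hp'
    obtain ⟨σ, hσ, hsσ⟩ := hs.supported
    obtain ⟨τ, hτ, hsτ⟩ := hs'.supported
    have hxσ := convexHull_min hsσ (convex_dilatedFace pos c _) hx
    have hyτ := convexHull_min hsτ (convex_dilatedFace pos c _) hy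
    have hyx : y = x := eq_of_mem_dilatedFace hinj hrange hc hτ hσ hyτ hxσ hxy
    subst hyx
    obtain ⟨μ, h0, h1, rfl⟩ := Finset.mem_convexHull'.1 hx
    obtain ⟨ν, k0, k1, k2⟩ := Finset.mem_convexHull'.1 hy
    have e1 := integral_points_cell_eq hs.integral hs.compatible h0 h1
    have e2 := integral_points_cell_eq hs'.integral hs'.compatible k0 k1
    rw [k2] at e2
    -- The common point is in the hull of the integral points of its own cell. By e1 and e2 these
    -- are the vertices of positive weight in s and also those in s', hence common to both.
    have hmem := Set.mem_image_of_mem (proj pos)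
      (mem_convexHull_integral_points_cell (∑ m ∈ s, μ m • m))
    rw [LinearMap.image_convexHull] at hmem
    refine convexHull_mono ?_ hmem
    rintro _ ⟨m, hm, rfl⟩
    have hm1 : m ∈ s := (e1 ▸ hm : m ∈ {m | m ∈ s ∧ 0 < μ m}).1
    have hm2 : m ∈ s' := (e2 ▸ hm : m ∈ {m | m ∈ s' ∧ 0 < ν m}).1
    exact ⟨Finset.mem_coe.2 (Finset.mem_image_of_mem _ hm1),
      Finset.mem_coe.2 (Finset.mem_image_of_mem _ hm2)⟩

variable (hinj : Function.Injective pos) (hrange : Set.range pos = T.vertices) (hc : 0 < c)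

theorem mem_refinedComplex_faces [DecidableEq (Fin n → ℝ)] {t : Finset (Fin n → ℝ)} :
    t ∈ (refinedComplex T pos hinj hrange c hc).faces ↔
      ∃ s, IsRefinedFace T pos c s ∧ t = s.image (proj pos) := by
  constructor
  · rintro ⟨s, hs, rfl⟩
    exact ⟨s, hs, by congr!⟩
  · rintro ⟨s, hs, rfl⟩
    exact ⟨s, hs, by congr!⟩

theorem simplices_refinedComplex :
    simplices (refinedComplex T pos hinj hrange c hc) =
      {C | ∃ σ ∈ T.faces, ∃ x ∈ dilatedFace pos c σ, C = proj pos '' cell x} := by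
  classical
  ext C
  constructor
  · rintro ⟨t, ht, rfl⟩
    obtain ⟨s, hs, rfl⟩ := (mem_refinedComplex_faces hinj hrange hc).1 ht
    obtain ⟨σ, hσ, hsσ⟩ := hs.supported
    obtain ⟨x, hx, hcell⟩ := hs.exists_cell_eq hsσ
    refine ⟨σ, hσ, x, hx, ?_⟩
    simp only [convexHull_image_proj, hcell]
  · rintro ⟨σ, hσ, x, hx, rfl⟩
    obtain ⟨s, hs, -, hcell⟩ := exists_isRefinedFace_cell hσ hx
    refine ⟨s.image (proj pos), (mem_refinedComplex_faces hinj hrange hc).2 ⟨s, hs, rfl⟩, ?_⟩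
    simp only [convexHull_image_proj, hcell]

theorem space_refinedComplex :
    (refinedComplex T pos hinj hrange c hc).space = (c : ℝ) • T.space := by
  have e : (refinedComplex T pos hinj hrange c hc).space =
      ⋃₀ simplices (refinedComplex T pos hinj hrange c hc) := by
    simp [SimplicialComplex.space, simplices, Set.sUnion_image]
  rw [e, simplices_refinedComplex, SimplicialComplex.space, Set.smul_set_iUnion₂]
  ext p
  simp only [Set.mem_iUnion]
  constructor
  · rintro ⟨_, ⟨σ, hσ, x, hx, rfl⟩, y, hy, rfl⟩
    refine ⟨σ, hσ, ?_⟩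
    rw [← proj_image_dilatedFace hinj hrange hσ hc]
    exact ⟨y, cell_subset_dilatedFace hx hy, rfl⟩
  · rintro ⟨σ, hσ, hp⟩
    rw [← proj_image_dilatedFace hinj hrange hσ hc] at hp
    obtain ⟨x, hx, rfl⟩ := hp
    exact ⟨_, ⟨σ, hσ, x, hx, rfl⟩, x, mem_cell_self x, rfl⟩

theorem finite_faces_refinedComplex : (refinedComplex T pos hinj hrange c hc).faces.Finite := by
  classical
  have hfin : {m : V → ℝ | IsIntegral m ∧ ∀ v, 0 ≤ m v ∧ m v ≤ c}.Finite :=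
    finite_setOf_isIntegral_of_bounded (fun _ => 0) (fun _ => (c : ℝ))
  refine ((hfin.toFinset.powerset.finite_toSet).image fun s => s.image (proj pos)).subset ?_
  intro t ht
  obtain ⟨s, hs, rfl⟩ := (mem_refinedComplex_faces hinj hrange hc).1 ht
  refine ⟨s, ?_, rfl⟩
  rw [Finset.mem_coe, Finset.mem_powerset]
  intro m hm
  obtain ⟨σ, hσ, hsσ⟩ := hs.supported
  rw [hfin.mem_toFinset]
  obtain ⟨h0, h1, -⟩ := hsσ hm
  exact ⟨hs.integral m hm, fun v => ⟨h0 v, h1 ▸ Finset.single_le_sum (fun u _ => h0 u)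
    (Finset.mem_univ v)⟩⟩

theorem isLatticeTriangulation_refinedComplex {P : Set (Fin n → ℝ)}
    (hT : IsLatticeTriangulation T P) :
    IsLatticeTriangulation (refinedComplex T pos hinj hrange c hc) ((c : ℝ) • P) where
  finite := finite_faces_refinedComplex hinj hrange hc
  vertices_subset := by
    classical
    intro p hp
    obtain ⟨s, hs, hps⟩ := (mem_refinedComplex_faces hinj hrange hc).1 hp
    obtain ⟨m, hm, rfl⟩ := Finset.mem_image.1 (hps ▸ Finset.mem_singleton_self p)
    exact proj_mem_latticePoints
      (fun v => hT.vertices_subset (hrange ▸ Set.mem_range_self v)) (hs.integral m hm)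
  space_eq := by rw [space_refinedComplex, hT.space_eq]

/-- Faces of the refinement inside a dilated face. -/
theorem simplices_refinedComplex_subset {σ : Finset (Fin n → ℝ)} (hσ : σ ∈ T.faces) :
    {C | C ∈ simplices (refinedComplex T pos hinj hrange c hc) ∧
      C ⊆ (c : ℝ) • convexHull ℝ (σ : Set (Fin n → ℝ))} =
      {C | ∃ x ∈ dilatedFace pos c σ, C = proj pos '' cell x} := by
  rw [simplices_refinedComplex]
  ext C
  constructor
  · rintro ⟨⟨τ, hτ, x, hx, rfl⟩, hsub⟩
    -- Containment at the single point x suffices: uniqueness of coordinates puts x in the dilation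
    -- of σ, and its cell is determined by x.
    have h1 := hsub (Set.mem_image_of_mem _ (mem_cell_self x))
    rw [← proj_image_dilatedFace hinj hrange hσ hc] at h1
    obtain ⟨y, hy, hyx⟩ := h1
    have := eq_of_mem_dilatedFace hinj hrange hc hσ hτ hy hx hyx
    exact ⟨x, this ▸ hy, rfl⟩
  · rintro ⟨x, hx, rfl⟩
    refine ⟨⟨σ, hσ, x, hx, rfl⟩, ?_⟩
    rw [← proj_image_dilatedFace hinj hrange hσ hc]
    exact Set.image_mono (cell_subset_dilatedFace hx)

end RefinedComplex

/-! ### Comparison with the type A dicing. -/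

section TypeA

/-- The linear map taking the unit vectors to the vertices of the simplex of type `A`. -/
noncomputable def typeAMap (d : ℕ) : (Fin (d + 1) → ℝ) →ₗ[ℝ] Fin (d + 1) → ℝ :=
  Fintype.linearCombination ℝ (typeAVertex d)

theorem typeAMap_apply (d : ℕ) (ξ : Fin (d + 1) → ℝ) :
    typeAMap d ξ = ∑ i, ξ i • typeAVertex d i := by
  simp [typeAMap, Fintype.linearCombination_apply]

/-- The bridge to cells: coordinates in the type A model are upper partial sums of barycentric
weights. -/
theorem typeAMap_apply_apply (d : ℕ) (ξ : Fin (d + 1) → ℝ) (k : Fin (d + 1)) :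
    typeAMap d ξ k = ∑ i ∈ Finset.univ.filter (k ≤ ·), ξ i := by
  have hv : ∀ i, typeAVertex d i k = if k ≤ i then 1 else 0 := fun i => by
    simp [typeAVertex, Finset.sum_apply, Pi.single_apply]
  rw [typeAMap_apply, Finset.sum_apply, Finset.sum_filter]
  refine Finset.sum_congr rfl fun i _ => ?_
  rw [Pi.smul_apply, hv]
  split_ifs <;> simp

theorem typeAMap_injective (d : ℕ) : Function.Injective (typeAMap d) := by
  rw [← LinearMap.ker_eq_bot, LinearMap.ker_eq_bot']
  intro ξ h
  have h0 : ∀ k, ∑ i ∈ Finset.univ.filter (k ≤ ·), ξ i = 0 := fun k => by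
    rw [← typeAMap_apply_apply, h]; rfl
  ext v
  rw [← sum_filter_le_sub_sum_filter_lt ξ v, h0, zero_sub, Pi.zero_apply, neg_eq_zero]
  by_cases hv : (Finset.univ.filter (v < ·)).Nonempty
  · have : Finset.univ.filter (v < ·) =
        Finset.univ.filter ((Finset.univ.filter (v < ·)).min' hv ≤ ·) := by
      ext u
      simp only [Finset.mem_filter, Finset.mem_univ, true_and]
      refine ⟨fun h => Finset.min'_le _ _ (by simpa using h), fun h => ?_⟩
      have := Finset.min'_mem _ hv
      simp only [Finset.mem_filter, Finset.mem_univ, true_and] at this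
      exact this.trans_le h
    rw [this, h0]
  · rw [Finset.not_nonempty_iff_eq_empty.1 hv, Finset.sum_empty]

theorem smul_typeASimplex_eq (d c : ℕ) (hc : 0 < c) :
    (c : ℝ) • typeASimplex d =
      typeAMap d '' {ξ | (∀ i, 0 ≤ ξ i) ∧ ∑ i, ξ i = c} := by
  have hc' : (0 : ℝ) < c := by exact_mod_cast hc
  have e : Set.range (typeAVertex d) =
      typeAMap d '' Set.range fun i j : Fin (d + 1) => if i = j then (1 : ℝ) else 0 := by
    rw [← Set.range_comp]
    congr 1
    ext1 i
    simp [typeAMap_apply, ite_smul]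
  rw [typeASimplex, e, ← LinearMap.image_convexHull, convexHull_basis_eq_stdSimplex,
    ← image_smul_set]
  congr 1
  ext ξ
  rw [Set.mem_smul_set_iff_inv_smul_mem₀ hc'.ne']
  simp only [stdSimplex, Set.mem_ofPred_eq, Pi.smul_apply, smul_eq_mul, ← Finset.mul_sum]
  rw [inv_mul_eq_one₀ hc'.ne', eq_comm (a := (c : ℝ))]
  simp [hc']

variable {n d : ℕ} {V : Type*} [LinearOrder V] {a : Fin (d + 1) → V}

theorem sum_extend (ha : StrictMono a) (ξ : Fin (d + 1) → ℝ) (U : Finset V) :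
    ∑ v ∈ U, Function.extend a ξ 0 v = ∑ i ∈ Finset.univ.filter (a · ∈ U), ξ i := by
  have h1 : ∑ v ∈ (Finset.univ.filter (a · ∈ U)).image a, Function.extend a ξ 0 v =
      ∑ v ∈ U, Function.extend a ξ 0 v := by
    refine Finset.sum_subset (fun v hv => ?_) fun v hv hnot => ?_
    · obtain ⟨i, hi, rfl⟩ := Finset.mem_image.1 hv
      exact (Finset.mem_filter.1 hi).2
    · refine Function.extend_apply' _ _ _ ?_
      rintro ⟨i, rfl⟩
      exact hnot (Finset.mem_image_of_mem _ (by simpa using hv))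
  rw [← h1, Finset.sum_image fun i _ j _ h => ha.injective h]
  exact Finset.sum_congr rfl fun i _ => ha.injective.extend_apply _ _ _

/-- The indices i with a i in U form a final segment. If it is nonempty, its minimum is k; if it is
empty, the sum is 0 = z₀ - c, as z₀ is the total. Hence the empty set adds no new hyperplanes: it
only costs an integer shift. -/
theorem exists_sum_extend_eq (ha : StrictMono a) (c : ℕ) {U : Finset V}
    (hU : IsUpperSet (U : Set V)) : ∃ (k : Fin (d + 1)) (e : ℤ), ∀ ξ : Fin (d + 1) → ℝ,
      ∑ i, ξ i = c → ∑ v ∈ U, Function.extend a ξ 0 v = typeAMap d ξ k + e := by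
  by_cases hne : (Finset.univ.filter (a · ∈ U)).Nonempty
  · refine ⟨(Finset.univ.filter (a · ∈ U)).min' hne, 0, fun ξ _ => ?_⟩
    rw [sum_extend ha, typeAMap_apply_apply, Int.cast_zero, add_zero]
    refine Finset.sum_congr ?_ fun _ _ => rfl
    ext i
    have hmem := Finset.min'_mem _ hne
    rw [Finset.mem_filter] at hmem
    simp only [Finset.mem_filter, Finset.mem_univ, true_and]
    exact ⟨fun h => Finset.min'_le _ _ (by simpa using h),
      fun h => hU (ha.monotone h) hmem.2⟩
  · refine ⟨0, -c, fun ξ hξ => ?_⟩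
    rw [sum_extend ha, typeAMap_apply_apply, Finset.not_nonempty_iff_eq_empty.1 hne]
    simp [hξ]

variable [Fintype V]

theorem sum_extend_filter_le (ha : StrictMono a) (ξ : Fin (d + 1) → ℝ) (k : Fin (d + 1)) :
    ∑ v ∈ Finset.univ.filter (a k ≤ ·), Function.extend a ξ 0 v = typeAMap d ξ k := by
  rw [sum_extend ha, typeAMap_apply_apply]
  refine Finset.sum_congr ?_ fun _ _ => rfl
  ext i
  simp [ha.le_iff_le]

/-- The slicing conditions of type `A` describe the cells. -/
theorem extend_mem_cell_iff (ha : StrictMono a) {c : ℕ} {ξ ξ₀ : Fin (d + 1) → ℝ}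
    (h : ∑ i, ξ i = c) (h₀ : ∑ i, ξ₀ i = c) :
    Function.extend a ξ 0 ∈ cell (Function.extend a ξ₀ 0) ↔ ∀ i j,
      (⌊typeAMap d ξ₀ i - typeAMap d ξ₀ j⌋ : ℝ) ≤ typeAMap d ξ i - typeAMap d ξ j ∧
      typeAMap d ξ i - typeAMap d ξ j ≤ (⌈typeAMap d ξ₀ i - typeAMap d ξ₀ j⌉ : ℝ) := by
  constructor
  · intro hmem i j
    have h1 := floor_le_of_mem_cell hmem (isUpperSet_filter_le (a i)) (isUpperSet_filter_le (a j))
    have h2 := hmem _ _ (isUpperSet_filter_le (a i)) (isUpperSet_filter_le (a j))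
    rw [sum_extend_filter_le ha, sum_extend_filter_le ha, sum_extend_filter_le ha,
      sum_extend_filter_le ha] at h1 h2
    exact ⟨h1, h2⟩
  · intro hb U W hU hW
    obtain ⟨i, e, hi⟩ := exists_sum_extend_eq ha c hU
    obtain ⟨j, e', hj⟩ := exists_sum_extend_eq ha c hW
    rw [hi ξ h, hi ξ₀ h₀, hj ξ h, hj ξ₀ h₀]
    have h1 := (hb i j).2
    have h2 : typeAMap d ξ₀ i + e - (typeAMap d ξ₀ j + e') =
        typeAMap d ξ₀ i - typeAMap d ξ₀ j + ((e - e' : ℤ) : ℝ) := by push_cast; ring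
    rw [h2, Int.ceil_add_intCast]
    push_cast
    linarith

theorem extend_mem_dilatedFace {pos : V → Fin n → ℝ} (ha : StrictMono a) {c : ℕ}
    {ξ : Fin (d + 1) → ℝ} (h0 : ∀ i, 0 ≤ ξ i) (h1 : ∑ i, ξ i = c) :
    Function.extend a ξ 0 ∈ dilatedFace pos c (Set.range fun i => pos (a i)) := by
  refine ⟨fun v => ?_, ?_, fun v hv => ?_⟩
  · by_cases hv : ∃ i, a i = v
    · obtain ⟨i, rfl⟩ := hv
      rw [ha.injective.extend_apply]; exact h0 i
    · rw [Function.extend_apply' _ _ _ hv]; rfl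
  · rw [sum_extend ha]; simp [h1]
  · refine Function.extend_apply' _ _ _ ?_
    rintro ⟨i, rfl⟩
    exact hv ⟨i, rfl⟩

theorem exists_eq_extend {pos : V → Fin n → ℝ} (hinj : Function.Injective pos)
    (ha : StrictMono a) {c : ℕ} {x : V → ℝ}
    (hx : x ∈ dilatedFace pos c (Set.range fun i => pos (a i))) :
    ∃ ξ : Fin (d + 1) → ℝ, (∀ i, 0 ≤ ξ i) ∧ ∑ i, ξ i = c ∧ x = Function.extend a ξ 0 := by
  have hext : x = Function.extend a (x ∘ a) 0 := by
    ext v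
    by_cases hv : ∃ i, a i = v
    · obtain ⟨i, rfl⟩ := hv
      rw [ha.injective.extend_apply]; rfl
    · rw [Function.extend_apply' _ _ _ hv]
      refine hx.2.2 v ?_
      rintro ⟨i, hi⟩
      exact hv ⟨i, hinj hi⟩
  refine ⟨x ∘ a, fun i => hx.1 _, ?_, hext⟩
  have h1 := hx.2.1
  rw [hext, sum_extend ha] at h1
  simpa using h1

theorem proj_extend (pos : V → Fin n → ℝ) (ha : StrictMono a) (ξ : Fin (d + 1) → ℝ) :
    proj pos (Function.extend a ξ 0) = ∑ i, ξ i • pos (a i) := by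
  rw [proj_apply]
  have h1 : ∑ v ∈ Finset.univ.image a, Function.extend a ξ 0 v • pos v =
      ∑ v, Function.extend a ξ 0 v • pos v := by
    refine Finset.sum_subset (Finset.subset_univ _) fun v _ hnot => ?_
    rw [Function.extend_apply' _ _ _ ?_, Pi.zero_apply, zero_smul]
    rintro ⟨i, rfl⟩
    exact hnot (Finset.mem_image_of_mem _ (Finset.mem_univ i))
  rw [← h1, Finset.sum_image fun i _ j _ h => ha.injective h]
  exact Finset.sum_congr rfl fun i _ => by rw [ha.injective.extend_apply]

/-- The canonical triangulation of a dilated ordered simplex consists of the images of the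
cells. -/
theorem canonicalTriangulation_eq {pos : V → Fin n → ℝ} (hinj : Function.Injective pos)
    (ha : StrictMono a) {c : ℕ} (hc : 0 < c) :
    canonicalTriangulation c (fun i => pos (a i)) =
      {C | ∃ x ∈ dilatedFace pos c (Set.range fun i => pos (a i)), C = proj pos '' cell x} := by
  have key : ∀ ξ₀ : Fin (d + 1) → ℝ, (∀ i, 0 ≤ ξ₀ i) → ∑ i, ξ₀ i = c →
      {p | ∃ ξ : Fin (d + 1) → ℝ, ∑ i, ξ i • typeAVertex d i ∈
        {z | z ∈ (c : ℝ) • typeASimplex d ∧ ∀ i j : Fin (d + 1),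
          (⌊typeAMap d ξ₀ i - typeAMap d ξ₀ j⌋ : ℝ) ≤ z i - z j ∧
          z i - z j ≤ (⌈typeAMap d ξ₀ i - typeAMap d ξ₀ j⌉ : ℝ)} ∧ ∑ i, ξ i • pos (a i) = p} =
      proj pos '' cell (Function.extend a ξ₀ 0) := by
    intro ξ₀ h0 h1
    ext p
    simp only [← typeAMap_apply, smul_typeASimplex_eq d c hc, Set.mem_ofPred_eq,
      (typeAMap_injective d).mem_set_image]
    constructor
    · rintro ⟨ξ, ⟨⟨-, hξ1⟩, hb⟩, rfl⟩
      exact ⟨_, (extend_mem_cell_iff ha hξ1 h1).2 hb, proj_extend pos ha ξ⟩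
    · rintro ⟨y, hy, rfl⟩
      obtain ⟨ξ, hξ0, hξ1, rfl⟩ := exists_eq_extend hinj ha
        (cell_subset_dilatedFace (extend_mem_dilatedFace ha h0 h1) hy)
      exact ⟨ξ, ⟨⟨hξ0, hξ1⟩, (extend_mem_cell_iff ha hξ1 h1).1 hy⟩, (proj_extend pos ha ξ).symm⟩
  ext C
  constructor
  · rintro ⟨D, ⟨y, hy, rfl⟩, rfl⟩
    rw [smul_typeASimplex_eq d c hc] at hy
    obtain ⟨ξ₀, ⟨h0, h1⟩, rfl⟩ := hy
    exact ⟨_, extend_mem_dilatedFace ha h0 h1, key ξ₀ h0 h1⟩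
  · rintro ⟨x, hx, rfl⟩
    obtain ⟨ξ₀, h0, h1, rfl⟩ := exists_eq_extend hinj ha hx
    refine ⟨_, ⟨typeAMap d ξ₀, ?_, rfl⟩, (key ξ₀ h0 h1).symm⟩
    rw [smul_typeASimplex_eq d c hc]
    exact ⟨ξ₀, ⟨h0, h1⟩, rfl⟩

end TypeA

/-! ### Flagness. -/

section Flag

/-- In a flag complex, pairwise adjacent vertices form a face. -/
theorem IsFlag.mem_faces {n : ℕ} {T : SimplicialComplex ℝ (Fin n → ℝ)}
    [DecidableEq (Fin n → ℝ)] (hT : IsFlag T)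
    {R : Finset (Fin n → ℝ)} (hne : R.Nonempty) (h : ∀ p ∈ R, ∀ q ∈ R, {p, q} ∈ T.faces) :
    R ∈ T.faces := by
  induction R using Finset.strongInduction with
  | H R ih =>
    by_contra hR
    have hsub : (R : Set (Fin n → ℝ)) ⊆ T.vertices := fun p hp => by
      have := h p hp p hp
      rwa [Finset.pair_eq_singleton] at this
    have hcard := hT R hne hsub hR fun M hM hMne =>
      ih M hM hMne fun p hp q hq => h p (hM.1 hp) q (hM.1 hq)
    obtain ⟨p, q, -, rfl⟩ := Finset.card_eq_two.1 hcard
    exact hR (h p (by simp) q (by simp))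

variable {n : ℕ} {V : Type*} [LinearOrder V] [Fintype V]
  {T : SimplicialComplex ℝ (Fin n → ℝ)} {pos : V → Fin n → ℝ} {c : ℕ}

/-- If a minimal non-face did not have two elements, all its pairs would be faces. Then its lifts
are pairwise compatible, and any two vertices of `T` in the union of their supports lie in a common
face, so this union is a face by flagness of `T`; thus the set would be a face. -/
theorem isFlag_refinedComplex (hinj : Function.Injective pos) (hrange : Set.range pos = T.vertices)
    (hc : 0 < c) (hT : IsFlag T) : IsFlag (refinedComplex T pos hinj hrange c hc) := by
  classical
  intro N hne hsub hN hmin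
  by_contra hcard
  have hlift : ∀ p ∈ N, ∃ m : V → ℝ, proj pos m = p ∧ IsIntegral m ∧
      ∃ σ ∈ T.faces, m ∈ dilatedFace pos c σ := by
    intro p hp
    obtain ⟨s, hs, hps⟩ := (mem_refinedComplex_faces hinj hrange hc).1 (hsub hp)
    obtain ⟨m, hm, hmp⟩ := Finset.mem_image.1 (hps ▸ Finset.mem_singleton_self p)
    obtain ⟨σ, hσ, hsσ⟩ := hs.supported
    exact ⟨m, hmp, hs.integral m hm, σ, hσ, hsσ hm⟩
  choose! m hmp hmi hmσ using hlift
  have hpair : ∀ p ∈ N, ∀ q ∈ N, ∃ s, IsRefinedFace T pos c s ∧ m p ∈ s ∧ m q ∈ s := by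
    intro p hp q hq
    have hss : ({p, q} : Finset (Fin n → ℝ)) ⊂ N := by
      refine Finset.ssubset_iff_subset_ne.2 ⟨by simp [Finset.insert_subset_iff, hp, hq], ?_⟩
      rintro rfl
      by_cases hpq : p = q
      · subst hpq
        rw [Finset.pair_eq_singleton] at hN
        exact hN (hsub hp)
      · exact hcard (Finset.card_pair hpq)
    obtain ⟨s, hs, hps⟩ := (mem_refinedComplex_faces hinj hrange hc).1 (hmin _ hss (by simp))
    obtain ⟨σ, hσ, hsσ⟩ := hs.supported
    -- The lift chosen beforehand for r may come from another face; uniqueness of coordinates places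
    -- it in s all the same.
    have huniq : ∀ r ∈ N, r ∈ s.image (proj pos) → m r ∈ s := by
      intro r hr hrs
      obtain ⟨m', hm', rfl⟩ := Finset.mem_image.1 hrs
      obtain ⟨τ, hτ, hmτ⟩ := hmσ _ hr
      rwa [eq_of_mem_dilatedFace hinj hrange hc hτ hσ hmτ (hsσ hm') (hmp _ hr)]
    exact ⟨s, hs, huniq p hp (hps ▸ by simp), huniq q hq (hps ▸ by simp)⟩
  set R : Finset (Fin n → ℝ) :=
    (Finset.univ.filter fun v => ∃ p ∈ N, m p v ≠ 0).image pos with hR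
  have hRmem : ∀ v, pos v ∈ R ↔ ∃ p ∈ N, m p v ≠ 0 := fun v => by
    simp [hR, hinj.eq_iff]
  have hRne : R.Nonempty := by
    obtain ⟨p, hp⟩ := hne
    obtain ⟨σ, hσ, hpσ⟩ := hmσ p hp
    obtain ⟨v, -, hv⟩ := Finset.exists_ne_zero_of_sum_ne_zero
      (hpσ.2.1.trans_ne (by exact_mod_cast hc.ne'))
    exact ⟨pos v, (hRmem v).2 ⟨p, hp, hv⟩⟩
  have hRface : R ∈ T.faces := by
    refine hT.mem_faces hRne fun a ha b hb => ?_
    obtain ⟨v, hv, rfl⟩ := Finset.mem_image.1 ha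
    obtain ⟨w, hw, rfl⟩ := Finset.mem_image.1 hb
    obtain ⟨p, hp, hpv⟩ := (hRmem v).1 ha
    obtain ⟨q, hq, hqw⟩ := (hRmem w).1 hb
    obtain ⟨s, hs, hps, hqs⟩ := hpair p hp q hq
    obtain ⟨σ, hσ, hsσ⟩ := hs.supported
    refine T.down_closed hσ ?_ (by simp)
    rw [Finset.insert_subset_iff, Finset.singleton_subset_iff]
    exact ⟨by_contra fun h => hpv ((hsσ hps).2.2 v h), by_contra fun h => hqw ((hsσ hqs).2.2 w h)⟩
  refine hN ((mem_refinedComplex_faces hinj hrange hc).2 ⟨N.image m, ⟨hne.image m, ?_, ?_, R,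
    hRface, ?_⟩, ?_⟩)
  · intro m' hm'
    obtain ⟨p, hp, rfl⟩ := Finset.mem_image.1 hm'
    exact hmi p hp
  · intro m₁ hm₁ m₂ hm₂
    obtain ⟨p, hp, rfl⟩ := Finset.mem_image.1 hm₁
    obtain ⟨q, hq, rfl⟩ := Finset.mem_image.1 hm₂
    obtain ⟨s, hs, hps, hqs⟩ := hpair p hp q hq
    exact hs.compatible _ hps _ hqs
  · intro m' hm'
    obtain ⟨p, hp, rfl⟩ := Finset.mem_image.1 (Finset.mem_coe.1 hm')
    obtain ⟨σ, hσ, hpσ⟩ := hmσ p hp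
    refine ⟨hpσ.1, hpσ.2.1, fun v hv => ?_⟩
    by_contra hne'
    exact hv ((hRmem v).2 ⟨p, hp, hne'⟩)
  · rw [Finset.image_image]
    ext p
    rw [Finset.mem_image]
    exact ⟨fun hp => ⟨p, hp, hmp p hp⟩, fun ⟨q, hq, hqp⟩ => by
      rw [← hqp, Function.comp_apply, hmp q hq]; exact hq⟩

end Flag

/-! ### Unimodularity through integral barycentric coordinates. -/

section Unimodular

variable {n : ℕ}

theorem sum_smul_mem_affineSpan {ι : Type*} [Fintype ι] {v : ι → Fin n → ℝ} {w : ι → ℝ}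
    (h : ∑ i, w i = 1) : ∑ i, w i • v i ∈ affineSpan ℝ (Set.range v) := by
  rw [← Finset.affineCombination_eq_linear_combination _ _ _ h]
  exact affineCombination_mem_affineSpan h v

theorem sum_smul_mem_latticePoints {ι : Type*} {s : Finset ι} {v : ι → Fin n → ℝ} {w : ι → ℝ}
    (hv : ∀ i ∈ s, v i ∈ latticePoints n) (hw : ∀ i ∈ s, ∃ k : ℤ, w i = k) :
    ∑ i ∈ s, w i • v i ∈ latticePoints n := by
  intro j
  choose! k hk using hw
  choose! l hl using fun i hi => hv i hi j
  refine ⟨∑ i ∈ s, k i * l i, ?_⟩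
  push_cast
  rw [Finset.sum_apply]
  exact Finset.sum_congr rfl fun i hi => by rw [Pi.smul_apply, smul_eq_mul, hk i hi, hl i hi]

/-- A lattice simplex is unimodular if its lattice points have integral barycentric
coordinates. -/
theorem isUnimodularSimplex_of_integral_weights {d : ℕ} {v : Fin (d + 1) → Fin n → ℝ}
    (hv : AffineIndependent ℝ v) (hl : ∀ i, v i ∈ latticePoints n)
    (hw : ∀ w : Fin (d + 1) → ℝ, ∑ i, w i = 1 → ∑ i, w i • v i ∈ latticePoints n →
      ∀ i, ∃ k : ℤ, w i = k) : IsUnimodularSimplex (convexHull ℝ (Set.range v)) := by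
  set f : (Fin d → ℝ) →ᵃ[ℝ] (Fin n → ℝ) :=
    (Fintype.linearCombination ℝ fun i : Fin d => v i.succ - v 0).toAffineMap +
      AffineMap.const ℝ _ (v 0) with hf
  set wt : (Fin d → ℝ) → Fin (d + 1) → ℝ := fun q => Fin.cons (1 - ∑ i, q i) q with hwt
  have hwt1 : ∀ q, ∑ i, wt q i = 1 := fun q => by simp [hwt, Fin.sum_univ_succ]
  have hfq : ∀ q, f q = ∑ i, wt q i • v i := fun q => by
    simp only [hf, AffineMap.coe_add, Pi.add_apply, LinearMap.coe_toAffineMap,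
      Fintype.linearCombination_apply, AffineMap.const_apply, hwt, Fin.sum_univ_succ, Fin.cons_zero,
      Fin.cons_succ, smul_sub, Finset.sum_sub_distrib, sub_smul, one_smul, Finset.sum_smul]
    abel
  have hwsurj : ∀ w : Fin (d + 1) → ℝ, ∑ i, w i = 1 → wt (fun i => w i.succ) = w := fun w h => by
    rw [Fin.sum_univ_succ] at h
    ext i
    refine Fin.cases ?_ (fun i => ?_) i
    · simp only [hwt, Fin.cons_zero]; linarith
    · simp [hwt]
  refine ⟨d, f, fun q q' h => ?_, ?_, ?_⟩
  · rw [hfq, hfq] at h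
    have := affineIndependent_iff.1 hv Finset.univ (fun i => wt q i - wt q' i)
      (by rw [Finset.sum_sub_distrib, hwt1, hwt1, sub_self])
      (by simp_rw [sub_smul]; rw [Finset.sum_sub_distrib, h, sub_self])
    ext i
    have h2 := this i.succ (Finset.mem_univ _)
    simp only [hwt, Fin.cons_succ] at h2
    linarith
  · rw [affineSpan_convexHull]
    ext p
    constructor
    · rintro ⟨q, hq, rfl⟩
      rw [hfq]
      refine ⟨sum_smul_mem_latticePoints (fun i _ => hl i) fun i _ => ?_,
        sum_smul_mem_affineSpan (hwt1 q)⟩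
      refine Fin.cases ?_ (fun i => ?_) i
      · obtain ⟨k, hk⟩ := IsIntegral.exists_sum_eq hq Finset.univ
        exact ⟨1 - k, by simp [hwt, hk]⟩
      · simpa [hwt] using hq i
    · rintro ⟨hp, hspan⟩
      obtain ⟨w, hw1, rfl⟩ := eq_affineCombination_of_mem_affineSpan_of_fintype hspan
      rw [Finset.affineCombination_eq_linear_combination _ _ _ hw1] at hp ⊢
      exact ⟨fun i => w i.succ, fun i => hw w hw1 hp i.succ, by rw [hfq, hwsurj w hw1]⟩
  · rw [standardSimplex, AffineMap.image_convexHull]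
    congr 1
    have h0 : f 0 = v 0 := by simp [hf]
    have h1 : ∀ i, f (Pi.single i 1) = v i.succ := fun i => by
      simp [hf, Fintype.linearCombination_apply, Pi.single_apply, ite_smul]
    rw [Set.image_insert_eq, h0, ← Set.range_comp]
    ext p
    simp only [Set.mem_insert_iff, Set.mem_range, Function.comp_apply, h1, Fin.exists_fin_succ]
    rw [eq_comm]

/-- The lattice points of the affine hull of a unimodular simplex have integral barycentric
coordinates. -/
theorem IsUnimodularSimplex.integral_weights {σ : Finset (Fin n → ℝ)}
    (hσ : AffineIndependent ℝ ((↑) : σ → Fin n → ℝ))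
    (h : IsUnimodularSimplex (convexHull ℝ (σ : Set (Fin n → ℝ)))) {μ : (Fin n → ℝ) → ℝ}
    (h1 : ∑ p ∈ σ, μ p = 1) (hp : ∑ p ∈ σ, μ p • p ∈ latticePoints n) :
    ∀ p ∈ σ, ∃ k : ℤ, μ p = k := by
  classical
  obtain ⟨d, f, hfinj, hlat, himg⟩ := h
  rw [standardSimplex, AffineMap.image_convexHull] at himg
  have hsub : ∀ p ∈ σ, p ∈ f '' _ := fun p hp => subset_of_convexHull_eq hσ himg hp
  have hspan : ∑ p ∈ σ, μ p • p ∈ affineSpan ℝ (convexHull ℝ (σ : Set (Fin n → ℝ))) := by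
    rw [affineSpan_convexHull, ← Finset.sum_coe_sort σ fun p => μ p • p]
    have := sum_smul_mem_affineSpan (v := ((↑) : σ → Fin n → ℝ)) (w := fun p => μ p)
      (by rw [Finset.sum_coe_sort σ μ, h1])
    simpa using this
  obtain ⟨q, hq, hfq⟩ : ∑ p ∈ σ, μ p • p ∈ f '' latticePoints d := by
    rw [hlat]; exact ⟨hp, hspan⟩
  choose! b hb hfb using hsub
  have hq' : q = ∑ p ∈ σ, μ p • b p := by
    apply hfinj
    rw [hfq]
    have e := Finset.map_affineCombination σ b μ h1 f
    rw [Finset.affineCombination_eq_linear_combination _ _ _ h1,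
      Finset.affineCombination_eq_linear_combination _ _ _ h1] at e
    rw [e]
    exact Finset.sum_congr rfl fun p hp => by rw [Function.comp_apply, hfb _ hp]
  have hbinj : ∀ p ∈ σ, ∀ p' ∈ σ, b p = b p' → p = p' := fun p hp p' hp' h => by
    rw [← hfb _ hp, ← hfb _ hp', h]
  -- The preimages b p are distinct points among 0 and the unit vectors, so the weight of p with b p
  -- = eᵢ is the i-th coordinate of the lattice point q. The weight over 0 is then 1 minus an
  -- integer.
  have hcase : ∀ p ∈ σ, b p ≠ 0 → ∃ k : ℤ, μ p = k := by
    intro p hp hne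
    obtain ⟨i, hi⟩ := (hb _ hp).resolve_left hne
    obtain ⟨k, hk⟩ := hq i
    refine ⟨k, ?_⟩
    rw [← hk, hq', Finset.sum_apply, Finset.sum_eq_single p]
    · simp [← hi]
    · intro p' hp' hne'
      rcases hb _ hp' with h0 | ⟨j, hj⟩
      · simp [h0]
      · have hij : i ≠ j := by
          rintro rfl
          exact hne' (hbinj p' hp' p hp (hj.symm.trans hi))
        simp [← hj, hij]
    · exact fun h => absurd hp h
  intro p hp
  by_cases hbp : b p = 0
  · have hother : ∀ p' ∈ σ.erase p, ∃ k : ℤ, μ p' = k := fun p' hp' =>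
      hcase p' (Finset.mem_of_mem_erase hp') fun h0 => Finset.ne_of_mem_erase hp'
        (hbinj p' (Finset.mem_of_mem_erase hp') p hp (h0.trans hbp.symm))
    choose! k hk using hother
    refine ⟨1 - ∑ p' ∈ σ.erase p, k p', ?_⟩
    push_cast
    rw [← Finset.sum_congr rfl hk, ← h1, ← Finset.add_sum_erase σ μ hp]
    ring
  · exact hcase p hp hbp

theorem exists_facet_superset {T : SimplicialComplex ℝ (Fin n → ℝ)} (hfin : T.faces.Finite)
    {σ : Finset (Fin n → ℝ)} (hσ : σ ∈ T.faces) : ∃ τ ∈ T.facets, σ ⊆ τ := by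
  obtain ⟨τ, hle, hτ⟩ := hfin.exists_le_maximal hσ
  exact ⟨τ, ⟨hτ.prop, fun t ht hsub => le_antisymm hsub (hτ.le_of_ge ht hsub)⟩, hle⟩

variable {V : Type*} [Fintype V]
  {T : SimplicialComplex ℝ (Fin n → ℝ)} {pos : V → Fin n → ℝ} {c : ℕ}

/-- Subtracting c - 1 times the unit vector of some vertex of τ reduces the total from c to 1 and
changes the projection by a lattice vector, so integrality of barycentric coordinates in τ applies.
-/
theorem isIntegral_of_proj_mem_latticePoints (hinj : Function.Injective pos)
    (hrange : Set.range pos = T.vertices)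
    (hlat : T.vertices ⊆ latticePoints n) {τ : Finset (Fin n → ℝ)} (hτ : τ ∈ T.faces)
    (hu : IsUnimodularSimplex (convexHull ℝ (τ : Set (Fin n → ℝ)))) {x : V → ℝ}
    (hsum : ∑ v, x v = c) (hx : ∀ v, pos v ∉ τ → x v = 0)
    (hp : proj pos x ∈ latticePoints n) : IsIntegral x := by
  classical
  obtain ⟨p₀, hp₀⟩ := T.nonempty_of_mem_faces hτ
  have hp₀v : p₀ ∈ T.vertices :=
    T.down_closed hτ (Finset.singleton_subset_iff.2 hp₀) (Finset.singleton_nonempty p₀)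
  obtain ⟨v₀, rfl⟩ : p₀ ∈ Set.range pos := hrange ▸ hp₀v
  set y : V → ℝ := x - ((c : ℝ) - 1) • Pi.single v₀ 1 with hy
  have hyτ : ∀ v, pos v ∉ τ → y v = 0 := fun v hv => by
    have : v ≠ v₀ := by rintro rfl; exact hv hp₀
    simp [hy, hx v hv, this]
  have hext : ∀ v, Function.extend pos y 0 (pos v) = y v := fun v => hinj.extend_apply _ _ _
  have hint := hu.integral_weights (T.indep hτ) (μ := Function.extend pos y 0) ?_ ?_
  · intro v
    have hyv : ∃ k : ℤ, y v = k := by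
      by_cases hv : pos v ∈ τ
      · simpa [hext] using hint _ hv
      · exact ⟨0, by simp [hyτ v hv]⟩
    obtain ⟨k, hk⟩ := hyv
    have hxv : x v = y v + ((c : ℝ) - 1) * (Pi.single v₀ 1 : V → ℝ) v := by simp [hy]
    by_cases hv : v = v₀
    · subst hv
      exact ⟨k + (c - 1), by rw [hxv, hk]; simp⟩
    · exact ⟨k, by rw [hxv, hk]; simp [hv]⟩
  · rw [sum_face_eq hinj hrange hτ]
    simp_rw [hext]
    have : ∑ v, y v = 1 := by
      simp only [hy, Pi.sub_apply, Pi.smul_apply, smul_eq_mul, Finset.sum_sub_distrib,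
        ← Finset.mul_sum, hsum, Finset.sum_pi_single', Finset.mem_univ, if_true]
      ring
    rw [← this]
    exact Finset.sum_congr rfl fun v _ => by
      split_ifs with hv
      · rfl
      · rw [hyτ v hv]
  · rw [sum_face_eq hinj hrange hτ]
    simp_rw [hext]
    have e : (∑ v, if pos v ∈ τ then y v • pos v else 0) = proj pos y := by
      rw [proj_apply]
      exact Finset.sum_congr rfl fun v _ => by
        split_ifs with hv
        · rfl
        · rw [hyτ v hv, zero_smul]
    rw [e, hy, map_sub, map_smul]
    have e2 : proj pos (Pi.single v₀ 1) = pos v₀ := by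
      simp [proj_apply, Pi.single_apply, ite_smul]
    rw [e2]
    intro i
    obtain ⟨k, hk⟩ := hp i
    obtain ⟨l, hl⟩ := hlat hp₀v i
    exact ⟨k - (c - 1) * l, by simp [hk, hl]⟩

/-- A lattice point in the affine hull of a refined face has an integral coordinate vector, and the
coefficient formula turns its upper sums into integral barycentric coordinates. The passage to a
facet τ is needed because only facets of `T` are assumed unimodular. -/
theorem isUnimodular_refinedComplex [LinearOrder V] (hinj : Function.Injective pos)
    (hrange : Set.range pos = T.vertices) (hc : 0 < c) (hfin : T.faces.Finite)
    (hlat : T.vertices ⊆ latticePoints n) (hT : IsUnimodular T) :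
    IsUnimodular (refinedComplex T pos hinj hrange c hc) := by
  classical
  rintro t ⟨ht, -⟩
  obtain ⟨s, hs, rfl⟩ := (mem_refinedComplex_faces hinj hrange hc).1 ht
  obtain ⟨σ, hσ, hsσ⟩ := hs.supported
  obtain ⟨τ, hτ, hστ⟩ := exists_facet_superset hfin hσ
  have hsτ := hsσ.trans (dilatedFace_mono pos c (Finset.coe_subset.2 hστ))
  obtain ⟨d, hd⟩ : ∃ d, s.card = d + 1 := ⟨s.card - 1, by have := hs.nonempty.card_pos; omega⟩
  have e : Fin (d + 1) ≃ s := (s.equivFinOfCardEq hd).symm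
  have hrng : (s.image (proj pos) : Set (Fin n → ℝ)) = Set.range fun i => proj pos (e i) := by
    ext p
    simp only [Finset.coe_image, Set.mem_image, Finset.mem_coe, Set.mem_range]
    exact ⟨fun ⟨m, hm, h⟩ => ⟨e.symm ⟨m, hm⟩, by simpa using h⟩,
      fun ⟨i, h⟩ => ⟨e i, (e i).2, h⟩⟩
  rw [hrng]
  refine isUnimodularSimplex_of_integral_weights ?_ ?_ ?_
  · have hemb : Function.Injective fun i => (⟨proj pos (e i),
        Finset.mem_image_of_mem _ (e i).2⟩ : (s.image (proj pos) : Finset _)) := fun i j hij =>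
      e.injective (Subtype.ext (hs.injOn hinj hrange (e i).2 (e j).2 (Subtype.ext_iff.1 hij)))
    exact (hs.affineIndependent hinj hrange).comp_embedding ⟨_, hemb⟩
  · exact fun i => proj_mem_latticePoints (fun v => hlat (hrange ▸ Set.mem_range_self v))
      (hs.integral _ (e i).2)
  · intro w hw1 hwp i
    set μ : (V → ℝ) → ℝ := fun m => if hm : m ∈ s then w (e.symm ⟨m, hm⟩) else 0 with hμ
    have hμe : ∀ i, μ (e i) = w i := fun i => by simp [hμ]
    have hμ1 : ∑ m ∈ s, μ m = 1 := by
      rw [← Finset.sum_coe_sort, ← Equiv.sum_comp e]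
      simpa only [hμe] using hw1
    have hμp : proj pos (∑ m ∈ s, μ m • m) = ∑ i, w i • proj pos (e i) := by
      rw [← Finset.sum_coe_sort s fun m => μ m • m, ← Equiv.sum_comp e, map_sum]
      simp only [hμe, map_smul]
    have hint : IsIntegral (∑ m ∈ s, μ m • m) := by
      refine isIntegral_of_proj_mem_latticePoints hinj hrange hlat hτ.1 (hT τ hτ) (c := c) ?_ ?_
        (hμp ▸ hwp)
      · simp only [Finset.sum_apply, Pi.smul_apply, smul_eq_mul]
        rw [Finset.sum_comm]
        simp_rw [← Finset.mul_sum]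
        rw [Finset.sum_congr rfl fun m hm => by rw [(hsσ hm).2.1], ← Finset.sum_mul, hμ1, one_mul]
      · intro v hv
        rw [Finset.sum_apply]
        exact Finset.sum_eq_zero fun m hm => by simp [(hsτ hm).2.2 v hv]
    obtain ⟨U, W, -, -, h⟩ := exists_coefficient_formula hs.integral hs.compatible (e i).2
    have hform := h μ
    rw [hμe, hμ1] at hform
    obtain ⟨k₁, hk₁⟩ := hint.exists_sum_eq U
    obtain ⟨k₂, hk₂⟩ := hint.exists_sum_eq W
    obtain ⟨k₃, hk₃⟩ := (hs.integral _ (e i).2).exists_sum_eq U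
    obtain ⟨k₄, hk₄⟩ := (hs.integral _ (e i).2).exists_sum_eq W
    exact ⟨k₁ - k₂ - (k₃ - k₄ - 1), by rw [hform, hk₁, hk₂, hk₃, hk₄]; push_cast; ring⟩

end Unimodular

/-! ### Regularity and supporting affine functions. -/

section RegularityCriterion

variable {n : ℕ}

/-- A triangulation is regular if every face is cut out by a supporting affine function. -/
theorem isRegular_of_supporting {T : SimplicialComplex ℝ (Fin n → ℝ)} {Q : Set (Fin n → ℝ)}
    (hT : IsLatticeTriangulation T Q) (hQ : Convex ℝ Q) (hfin : (Q ∩ latticePoints n).Finite)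
    (w : (Fin n → ℝ) → ℝ)
    (h : ∀ s ∈ T.faces, ∃ (η : Fin n → ℝ) (ζ : ℝ), ∀ a ∈ Q ∩ latticePoints n,
      η ⬝ᵥ a + ζ ≤ w a ∧
      (w a = η ⬝ᵥ a + ζ ↔ a ∈ convexHull ℝ (s : Set (Fin n → ℝ)))) : IsRegular T Q := by
  classical
  have hvert : ∀ s ∈ T.faces, ∀ a ∈ s, a ∈ Q ∩ latticePoints n := fun s hs a ha =>
    ⟨hT.space_eq ▸ SimplicialComplex.convexHull_subset_space hs (subset_convexHull ℝ _ ha),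
      hT.vertices_subset (T.down_closed hs (Finset.singleton_subset_iff.2 ha)
        (Finset.singleton_nonempty a))⟩
  refine ⟨w, Set.Subset.antisymm ?_ ?_⟩
  · rintro _ ⟨s, hs, rfl⟩
    obtain ⟨η, ζ, hη⟩ := h s hs
    refine ⟨convexHull_nonempty_iff.2 (T.nonempty_of_mem_faces hs), η, ζ, fun a ha => (hη a ha).1,
      Set.Subset.antisymm (convexHull_mono fun a ha => ?_)
        (convexHull_min (fun a ha => ((hη a ha.1).2.1 ha.2)) (convex_convexHull ℝ _))⟩
    have ha' := hvert s hs a ha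
    exact ⟨ha', (hη a ha').2.2 (subset_convexHull ℝ _ ha)⟩
  · rintro F ⟨hFne, η, ζ, hle, rfl⟩
    have hAfin : {a | a ∈ Q ∩ latticePoints n ∧ w a = η ⬝ᵥ a + ζ}.Finite :=
      hfin.subset fun a ha => ha.1
    obtain ⟨A, hA⟩ := hAfin.exists_finset_coe
    rw [← hA] at hFne ⊢
    have hA' : ∀ a, a ∈ A ↔ a ∈ Q ∩ latticePoints n ∧ w a = η ⬝ᵥ a + ζ := fun a => by
      rw [← Finset.mem_coe, hA]; rfl
    have hAne : A.Nonempty := Finset.coe_nonempty.1 (convexHull_nonempty_iff.1 hFne)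
    have hcard : (0 : ℝ) < A.card := by exact_mod_cast hAne.card_pos
    set k : (Fin n → ℝ) → ℝ := fun _ => (A.card : ℝ)⁻¹ with hk
    have hkpos : ∀ a, 0 < k a := fun a => inv_pos.2 hcard
    have hk1 : ∑ a ∈ A, k a = 1 := by
      rw [Finset.sum_const, nsmul_eq_mul, mul_inv_cancel₀ hcard.ne']
    -- The barycenter of A is compared with the face s' of `T` having it in its relative interior.
    -- Each of the two supporting functions is bounded by the other at the points where the other is
    -- tight, so they agree at the barycenter; as all coefficients are positive, they agree on A and
    -- on s'.
    have hpQ : ∑ a ∈ A, k a • a ∈ Q :=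
      hQ.sum_mem (fun a _ => (hkpos a).le) hk1 fun a ha => ((hA' a).1 ha).1.1
    obtain ⟨s, hs, hps⟩ := SimplicialComplex.mem_space_iff.1 (hT.space_eq.symm ▸ hpQ)
    obtain ⟨μ, hμ0, hμ1, hμp⟩ := Finset.mem_convexHull'.1 hps
    set s' := s.filter fun u => μ u ≠ 0 with hs'
    have hμ1' : ∑ u ∈ s', μ u = 1 := by rw [hs', Finset.sum_filter_ne_zero, hμ1]
    have hμp' : ∑ u ∈ s', μ u • u = ∑ a ∈ A, k a • a := by
      rw [← hμp, hs', Finset.sum_filter]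
      exact Finset.sum_congr rfl fun u _ => by
        split_ifs with h
        · rfl
        · rw [not_not.1 h, zero_smul]
    have hs'ne : s'.Nonempty := by
      by_contra hne
      rw [Finset.not_nonempty_iff_eq_empty.1 hne] at hμ1'
      simp at hμ1'
    have hs'T : s' ∈ T.faces := T.down_closed hs (Finset.filter_subset _ _) hs'ne
    have hμpos : ∀ u ∈ s', 0 < μ u := fun u hu =>
      lt_of_le_of_ne (hμ0 u (Finset.mem_filter.1 hu).1) (Finset.mem_filter.1 hu).2.symm
    obtain ⟨η', ζ', hη'⟩ := h s' hs'T
    have hw' : ∀ u ∈ s', w u = η' ⬝ᵥ u + ζ' := fun u hu =>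
      (hη' u (hvert s' hs'T u hu)).2.2 (subset_convexHull ℝ _ hu)
    have hle1 : ∀ a ∈ A, k a * (η' ⬝ᵥ a + ζ') ≤ k a * (η ⬝ᵥ a + ζ) := fun a ha => by
      rw [← ((hA' a).1 ha).2]
      exact mul_le_mul_of_nonneg_left (hη' a ((hA' a).1 ha).1).1 (hkpos a).le
    have hle2 : ∀ u ∈ s', μ u * (η ⬝ᵥ u + ζ) ≤ μ u * (η' ⬝ᵥ u + ζ') := fun u hu => by
      rw [← hw' u hu]
      exact mul_le_mul_of_nonneg_left (hle u (hvert s' hs'T u hu)) (hμpos u hu).le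
    have hs1 := Finset.sum_le_sum hle1
    have hs2 := Finset.sum_le_sum hle2
    rw [← dotProduct_combination hk1, ← dotProduct_combination hk1] at hs1
    rw [← dotProduct_combination hμ1', ← dotProduct_combination hμ1', hμp'] at hs2
    have heq := le_antisymm hs1 hs2
    have heq1 := heq
    rw [dotProduct_combination hk1, dotProduct_combination hk1,
      Finset.sum_eq_sum_iff_of_le hle1] at heq1
    have heq2 := heq.symm
    rw [← hμp', dotProduct_combination hμ1', dotProduct_combination hμ1',
      Finset.sum_eq_sum_iff_of_le hle2] at heq2
    refine ⟨s', hs'T, Set.Subset.antisymm (convexHull_mono fun u hu => ?_)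
      (convexHull_min (fun a ha => ?_) (convex_convexHull ℝ _))⟩
    · refine Finset.mem_coe.2 ((hA' u).2 ⟨hvert s' hs'T u hu, ?_⟩)
      rw [hw' u hu]
      exact (mul_left_cancel₀ (hμpos u hu).ne' (heq2 u hu)).symm
    · have ha' := (hA' a).1 ha
      refine (hη' a ha'.1).2.1 ?_
      rw [ha'.2]
      exact (mul_left_cancel₀ (hkpos a).ne' (heq1 a ha)).symm

/-- Every face of a regular triangulation is cut out by an affine function which lies strictly
below the weights of the other vertices. -/
theorem exists_supporting_of_regular {T : SimplicialComplex ℝ (Fin n → ℝ)} {P : Set (Fin n → ℝ)}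
    (hT : IsLatticeTriangulation T P) {w : (Fin n → ℝ) → ℝ}
    (hw : simplices T = regularSubdivision P w) {σ : Finset (Fin n → ℝ)} (hσ : σ ∈ T.faces) :
    ∃ (η : Fin n → ℝ) (ζ : ℝ), (∀ p ∈ σ, w p = η ⬝ᵥ p + ζ) ∧
      ∀ p ∈ T.vertices, p ∉ σ → η ⬝ᵥ p + ζ < w p := by
  have hmem : convexHull ℝ (σ : Set (Fin n → ℝ)) ∈ regularSubdivision P w := by
    rw [← hw]; exact ⟨σ, hσ, rfl⟩
  obtain ⟨-, η, ζ, hle, heq⟩ := hmem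
  refine ⟨η, ζ, fun p hp => (subset_of_convexHull_eq (T.indep hσ) heq.symm hp).2,
    fun p hp hpσ => ?_⟩
  have hpP : p ∈ P ∩ latticePoints n :=
    ⟨hT.space_eq ▸ SimplicialComplex.vertices_subset_space hp, hT.vertices_subset hp⟩
  refine lt_of_le_of_ne (hle p hpP) fun h => hpσ ?_
  rw [← SimplicialComplex.vertex_mem_convexHull_iff hp hσ, heq]
  exact subset_convexHull ℝ _ ⟨hpP, h.symm⟩

theorem finite_inter_latticePoints {Q : Set (Fin n → ℝ)} (hQ : Bornology.IsBounded Q) :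
    (Q ∩ latticePoints n).Finite := by
  obtain ⟨R, hR⟩ := hQ.exists_norm_le
  refine (finite_setOf_isIntegral_of_bounded (fun _ => -R) (fun _ => R)).subset ?_
  rintro p ⟨hp, hl⟩
  exact ⟨hl, fun i => abs_le.1 ((norm_le_pi_norm p i).trans (hR p hp))⟩

end RegularityCriterion

/-! ### A convex function whose domains of linearity are the cells. -/

section ConvexWeights

/-- The piecewise linear function interpolating the squares of the integers. -/
noncomputable def interpSq (t : ℝ) : ℝ := (2 * ⌊t⌋ + 1) * t - ⌊t⌋ * (⌊t⌋ + 1)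

/-- The line is the chord of t² over the unit interval around t₀, or the tangent of t² at t₀ when t₀
is an integer; it touches the interpolation exactly on [⌊t₀⌋, ⌈t₀⌉]. -/
theorem le_interpSq (t₀ t : ℝ) :
    ((⌊t₀⌋ : ℝ) + ⌈t₀⌉) * t - ⌊t₀⌋ * ⌈t₀⌉ ≤ interpSq t ∧
      (interpSq t = ((⌊t₀⌋ : ℝ) + ⌈t₀⌉) * t - ⌊t₀⌋ * ⌈t₀⌉ ↔ ⌊t₀⌋ ≤ t ∧ t ≤ ⌈t₀⌉) := by
  have hj1 := Int.floor_le t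
  have hj2 := Int.lt_floor_add_one t
  have hcase : ⌈t₀⌉ = ⌊t₀⌋ ∨ ⌈t₀⌉ = ⌊t₀⌋ + 1 := by
    have h1 := Int.floor_le_ceil t₀
    have h2 := Int.ceil_le_floor_add_one t₀
    omega
  generalize ⌊t₀⌋ = k at *
  rw [interpSq]
  generalize ⌊t⌋ = j at *
  rcases hcase with h | h <;> rw [h]
  · have e : (2 * (j : ℝ) + 1) * t - j * (j + 1) - ((k + k) * t - k * k) =
        (t - k) ^ 2 + (t - j) * (j + 1 - t) := by ring
    have h1 : 0 ≤ (t - j) * (j + 1 - t) := mul_nonneg (by linarith) (by linarith)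
    refine ⟨by nlinarith [sq_nonneg (t - k)], fun h => ?_, fun h => ?_⟩
    · have h3 : (t - k) ^ 2 = 0 := le_antisymm (by linarith) (sq_nonneg _)
      have h4 := pow_eq_zero_iff (two_ne_zero) |>.1 h3
      constructor <;> linarith
    · have htk : t = k := le_antisymm h.2 h.1
      have hjk : j = k := by
        have h1 : j ≤ k := by exact_mod_cast htk ▸ hj1
        have h2 : k < j + 1 := by exact_mod_cast htk ▸ hj2
        omega
      subst hjk
      rw [htk]; ring
  · push_cast
    have e : (2 * (j : ℝ) + 1) * t - j * (j + 1) - ((k + (k + 1)) * t - k * (k + 1)) =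
        (j - k) * (2 * t - j - k - 1) := by ring
    rcases lt_trichotomy j k with hjk | hjk | hjk
    · have hjk' : (j : ℝ) + 1 ≤ k := by exact_mod_cast hjk
      have hpos : 0 < ((j : ℝ) - k) * (2 * t - j - k - 1) :=
        mul_pos_of_neg_of_neg (by linarith) (by linarith)
      exact ⟨by linarith, fun h => by linarith, fun h => by linarith [h.1]⟩
    · subst hjk
      exact ⟨by linarith, fun _ => ⟨hj1, hj2.le⟩, fun _ => by ring⟩
    · have hjk' : (k : ℝ) + 1 ≤ j := by exact_mod_cast hjk
      have h0 : 0 ≤ 2 * t - j - k - 1 := by linarith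
      have hnn : 0 ≤ ((j : ℝ) - k) * (2 * t - j - k - 1) := mul_nonneg (by linarith) h0
      refine ⟨by linarith, fun h => ?_, fun h => ?_⟩
      · have hz : ((j : ℝ) - k) * (2 * t - j - k - 1) = 0 := by linarith
        rcases mul_eq_zero.1 hz with hz | hz
        · linarith
        · constructor <;> linarith
      · have : 2 * t - j - k - 1 = 0 := by linarith [h.2]
        rw [this, mul_zero] at e
        linarith

variable {V : Type*} [LinearOrder V] [Fintype V]

open Classical in
/-- The pairs of upper sets. -/
noncomputable def upperPairs (V : Type*) [LinearOrder V] [Fintype V] :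
    Finset (Finset V × Finset V) :=
  Finset.univ.filter fun p => IsUpperSet (p.1 : Set V) ∧ IsUpperSet (p.2 : Set V)

/-- A convex function whose domains of linearity are the cells. -/
noncomputable def cellWeight (x : V → ℝ) : ℝ :=
  ∑ p ∈ upperPairs V, interpSq (∑ v ∈ p.1, x v - ∑ v ∈ p.2, x v)

/-- Each cell is cut out by a linear function supporting `cellWeight`. -/
theorem exists_supporting_cell {c : ℕ} (hc : 0 < c) (x₀ : V → ℝ) :
    ∃ b : V → ℝ, ∀ x : V → ℝ, ∑ v, x v = c →
      ∑ v, x v * b v ≤ cellWeight x ∧ (cellWeight x = ∑ v, x v * b v ↔ x ∈ cell x₀) := by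
  have hc' : (c : ℝ) ≠ 0 := by exact_mod_cast hc.ne'
  set t₀ : Finset V × Finset V → ℝ := fun p => ∑ v ∈ p.1, x₀ v - ∑ v ∈ p.2, x₀ v with ht₀
  -- The constant terms of the supporting lines are made linear by a factor (∑ x_v)/c, which is 1 on
  -- vectors of total c.
  set L : (V → ℝ) →ₗ[ℝ] ℝ := ∑ p ∈ upperPairs V,
    (((⌊t₀ p⌋ : ℝ) + ⌈t₀ p⌉) • (∑ v ∈ p.1, LinearMap.proj (R := ℝ) (φ := fun _ : V => ℝ) v -
      ∑ v ∈ p.2, LinearMap.proj (R := ℝ) (φ := fun _ : V => ℝ) v) -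
      ((⌊t₀ p⌋ : ℝ) * ⌈t₀ p⌉ / c) • ∑ v, LinearMap.proj (R := ℝ) (φ := fun _ : V => ℝ) v) with hL
  refine ⟨fun v => L (Pi.single v 1), fun x hx => ?_⟩
  have hLb : ∑ v, x v * L (Pi.single v 1) = L x := by
    rw [LinearMap.pi_apply_eq_sum_univ L x]
    refine Finset.sum_congr rfl fun v _ => ?_
    rw [smul_eq_mul]
    congr 2
    ext u
    simp [Pi.single_apply, eq_comm]
  have hLx : L x = ∑ p ∈ upperPairs V, (((⌊t₀ p⌋ : ℝ) + ⌈t₀ p⌉) *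
      (∑ v ∈ p.1, x v - ∑ v ∈ p.2, x v) - ⌊t₀ p⌋ * ⌈t₀ p⌉) := by
    simp only [hL, LinearMap.sum_apply, LinearMap.sub_apply, LinearMap.smul_apply,
      LinearMap.proj_apply, smul_eq_mul, hx, div_mul_cancel₀ _ hc']
  rw [hLb, hLx, cellWeight]
  have hle : ∀ p ∈ upperPairs V, ((⌊t₀ p⌋ : ℝ) + ⌈t₀ p⌉) *
      (∑ v ∈ p.1, x v - ∑ v ∈ p.2, x v) - ⌊t₀ p⌋ * ⌈t₀ p⌉ ≤
      interpSq (∑ v ∈ p.1, x v - ∑ v ∈ p.2, x v) := fun p _ => (le_interpSq _ _).1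
  refine ⟨Finset.sum_le_sum hle, ?_⟩
  rw [eq_comm, Finset.sum_eq_sum_iff_of_le hle]
  constructor
  · intro h U W hU hW
    exact ((le_interpSq _ _).2.1 (h (U, W) (by simp [upperPairs, hU, hW])).symm).2
  · intro h p hp
    have hp' : IsUpperSet (p.1 : Set V) ∧ IsUpperSet (p.2 : Set V) := by
      simpa [upperPairs] using hp
    exact ((le_interpSq _ _).2.2 ⟨floor_le_of_mem_cell h hp'.1 hp'.2, h _ _ hp'.1 hp'.2⟩).symm

end ConvexWeights

/-! ### Regularity of the refinement. -/

section RegularRefinement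

open Filter Topology

variable {n : ℕ} {V : Type*} [LinearOrder V] [Fintype V]
  {T : SimplicialComplex ℝ (Fin n → ℝ)} {pos : V → Fin n → ℝ} {c : ℕ}

/-- A face of the refinement is cut out by an affine function supporting a small perturbation of
the weights of the original triangulation. -/
theorem eventually_exists_supporting (hinj : Function.Injective pos)
    (hrange : Set.range pos = T.vertices) (hc : 0 < c) {P : Set (Fin n → ℝ)}
    (hT : IsLatticeTriangulation T P) {w : (Fin n → ℝ) → ℝ}
    (hw : simplices T = regularSubdivision P w) {s : Finset (V → ℝ)}
    (hs : IsRefinedFace T pos c s) :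
    ∀ᶠ ε in 𝓝[>] (0 : ℝ), ∃ (η : Fin n → ℝ) (ζ : ℝ), ∀ σ ∈ T.faces,
      ∀ x ∈ dilatedFace pos c (σ : Set (Fin n → ℝ)),
        η ⬝ᵥ proj pos x + ζ ≤ ∑ v, x v * w (pos v) + ε * cellWeight x ∧
        (∑ v, x v * w (pos v) + ε * cellWeight x = η ⬝ᵥ proj pos x + ζ ↔
          x ∈ convexHull ℝ (s : Set (V → ℝ))) := by
  classical
  obtain ⟨σ, hσ, hsσ⟩ := hs.supported
  obtain ⟨x₀, hx₀, hcell⟩ := hs.exists_cell_eq hsσ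
  obtain ⟨b, hb⟩ := exists_supporting_cell hc x₀
  obtain ⟨η, ζ, hη1, hη2⟩ := exists_supporting_of_regular hT hw hσ
  obtain ⟨η', ζ', hη'⟩ := exists_affine_interpolation (T.indep hσ) (Function.extend pos b 0)
  have hη'b : ∀ v, pos v ∈ σ → η' ⬝ᵥ pos v + ζ' = b v := fun v hv => by
    rw [hη' _ hv, hinj.extend_apply]
  -- r is the gap at the vertices of `T`. It vanishes on σ, where both affine functions interpolate.
  -- Off σ its first term is positive, and for small ε the second, of unknown sign, cannot spoil
  -- this.
  set r : ℝ → V → ℝ := fun ε v => w (pos v) - (η ⬝ᵥ pos v + ζ) + ε * (b v - (η' ⬝ᵥ pos v + ζ'))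
    with hr
  have hr0 : ∀ ε v, pos v ∈ σ → r ε v = 0 := fun ε v hv => by
    simp only [hr, hη1 _ hv, hη'b v hv]; ring
  have hrpos : ∀ᶠ ε in 𝓝[>] (0 : ℝ), ∀ v, pos v ∉ σ → 0 < r ε v := by
    rw [eventually_all]
    intro v
    by_cases hv : pos v ∈ σ
    · exact Eventually.of_forall fun ε h => absurd hv h
    · have hcont : Continuous fun ε => r ε v := by simp only [hr]; fun_prop
      have hlt : 0 < r 0 v := by
        simp only [hr, zero_mul, add_zero, sub_pos]
        exact hη2 _ (hrange ▸ Set.mem_range_self v) hv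
      filter_upwards [(hcont.tendsto 0).eventually_const_lt hlt |>.filter_mono
        nhdsWithin_le_nhds] with ε hε _ using hε
  filter_upwards [hrpos, self_mem_nhdsWithin] with ε hε hεpos
  have hεpos' : 0 < ε := hεpos
  -- The constant term carries a factor c because coordinate vectors have total c.
  refine ⟨η + ε • η', c * (ζ + ε * ζ'), fun τ hτ x hx => ?_⟩
  obtain ⟨hb1, hb2⟩ := hb x hx.2.1
  have hid : ∑ v, x v * w (pos v) + ε * cellWeight x -
      ((η + ε • η') ⬝ᵥ proj pos x + c * (ζ + ε * ζ')) =
      ∑ v, x v * r ε v + ε * (cellWeight x - ∑ v, x v * b v) := by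
    rw [dotProduct_proj hx.2.1, mul_sub, Finset.mul_sum]
    have : ∀ a b c d e : ℝ, a - c = d - e → a + b - c = d + (b - e) := fun _ _ _ _ _ h => by
      linarith
    apply this
    rw [← Finset.sum_sub_distrib, ← Finset.sum_sub_distrib]
    refine Finset.sum_congr rfl fun v _ => ?_
    simp only [hr, add_dotProduct, smul_dotProduct, smul_eq_mul]
    ring
  have hnn : ∀ v, 0 ≤ r ε v := fun v => by
    by_cases hv : pos v ∈ σ
    · rw [hr0 ε v hv]
    · exact (hε v hv).le
  have h1 : 0 ≤ ∑ v, x v * r ε v := Finset.sum_nonneg fun v _ => mul_nonneg (hx.1 v) (hnn v)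
  have h2 : 0 ≤ ε * (cellWeight x - ∑ v, x v * b v) :=
    mul_nonneg hεpos'.le (by linarith)
  refine ⟨by linarith, fun h => ?_, fun h => ?_⟩
  · have h3 : ε * (cellWeight x - ∑ v, x v * b v) = 0 := by linarith
    have h4 := (mul_eq_zero.1 h3).resolve_left hεpos'.ne'
    rw [← hcell]
    exact hb2.1 (by linarith)
  · rw [← hcell] at h
    have hxσ := cell_subset_dilatedFace hx₀ h
    have h3 : ∑ v, x v * r ε v = 0 := Finset.sum_eq_zero fun v _ => by
      by_cases hv : pos v ∈ σ
      · rw [hr0 ε v hv, mul_zero]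
      · rw [hxσ.2.2 v hv, zero_mul]
    rw [h3, sub_eq_zero.2 (hb2.2 h), mul_zero, add_zero] at hid
    linarith

/-- Since the refinement has finitely many faces, a single ε works for all of them. The weight of a
point of cP is evaluated on its coordinate vector X p, so it is well defined across faces. -/
theorem isRegular_refinedComplex (hinj : Function.Injective pos)
    (hrange : Set.range pos = T.vertices) (hc : 0 < c) {P : Set (Fin n → ℝ)}
    (hP : IsLatticePolytope P) (hT : IsLatticeTriangulation T P) (hreg : IsRegular T P) :
    IsRegular (refinedComplex T pos hinj hrange c hc) ((c : ℝ) • P) := by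
  classical
  obtain ⟨w, hw⟩ := hreg
  obtain ⟨A, -, hPA⟩ := hP
  have hconv : Convex ℝ ((c : ℝ) • P) := by
    rw [hPA]; exact (convex_convexHull ℝ _).smul _
  have hbdd : Bornology.IsBounded ((c : ℝ) • P) := by
    rw [hPA]; exact (isBounded_convexHull.2 A.finite_toSet.isBounded).smul₀ _
  have hev : ∀ᶠ ε in 𝓝[>] (0 : ℝ), ∀ t ∈ (refinedComplex T pos hinj hrange c hc).faces,
      ∃ (η : Fin n → ℝ) (ζ : ℝ), ∀ σ ∈ T.faces,
      ∀ x ∈ dilatedFace pos c (σ : Set (Fin n → ℝ)),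
        η ⬝ᵥ proj pos x + ζ ≤ ∑ v, x v * w (pos v) + ε * cellWeight x ∧
        (∑ v, x v * w (pos v) + ε * cellWeight x = η ⬝ᵥ proj pos x + ζ ↔
          proj pos x ∈ convexHull ℝ (t : Set (Fin n → ℝ))) := by
    rw [eventually_all_finite (finite_faces_refinedComplex hinj hrange hc)]
    intro t ht
    obtain ⟨s, hs, rfl⟩ := (mem_refinedComplex_faces hinj hrange hc).1 ht
    filter_upwards [eventually_exists_supporting hinj hrange hc hT hw hs] with ε hε
    obtain ⟨η, ζ, h⟩ := hε
    refine ⟨η, ζ, fun σ hσ x hx => ⟨(h σ hσ x hx).1, (h σ hσ x hx).2.trans ?_⟩⟩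
    rw [convexHull_image_proj]
    refine ⟨fun hxs => ⟨x, hxs, rfl⟩, ?_⟩
    rintro ⟨y, hy, hyx⟩
    obtain ⟨τ, hτ, hsτ⟩ := hs.supported
    exact eq_of_mem_dilatedFace hinj hrange hc hτ hσ
      (convexHull_min hsτ (convex_dilatedFace pos c _) hy) hx hyx ▸ hy
  obtain ⟨ε, hε⟩ := hev.exists
  have hlift : ∀ p ∈ (c : ℝ) • P, ∃ x, proj pos x = p ∧ ∃ σ ∈ T.faces,
      x ∈ dilatedFace pos c (σ : Set (Fin n → ℝ)) := by
    intro p hp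
    rw [← hT.space_eq, SimplicialComplex.space, Set.smul_set_iUnion₂] at hp
    simp only [Set.mem_iUnion] at hp
    obtain ⟨σ, hσ, hpσ⟩ := hp
    rw [← proj_image_dilatedFace hinj hrange hσ hc] at hpσ
    obtain ⟨x, hx, rfl⟩ := hpσ
    exact ⟨x, rfl, σ, hσ, hx⟩
  choose! X hX1 hX2 using hlift
  refine isRegular_of_supporting (isLatticeTriangulation_refinedComplex hinj hrange hc hT) hconv
    (finite_inter_latticePoints hbdd)
    (fun p => ∑ v, X p v * w (pos v) + ε * cellWeight (X p)) fun t ht => ?_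
  obtain ⟨η, ζ, h⟩ := hε t ht
  refine ⟨η, ζ, fun a ha => ?_⟩
  obtain ⟨σ, hσ, hxσ⟩ := hX2 a ha.1
  have := h σ hσ _ hxσ
  rwa [hX1 a ha.1] at this

end RegularRefinement

/-! ### Assembly, with V the vertex set of `T` in the given order. -/

section Main

variable {n : ℕ} {V : Type*} [LinearOrder V] [Fintype V]
  {T : SimplicialComplex ℝ (Fin n → ℝ)} {pos : V → Fin n → ℝ} {c : ℕ}

theorem exists_strictMono_range_eq (hrange : Set.range pos = T.vertices)
    {σ : Finset (Fin n → ℝ)} (hσ : σ ∈ T.faces) :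
    ∃ (d : ℕ) (a : Fin (d + 1) → V), StrictMono a ∧
      (σ : Set (Fin n → ℝ)) = Set.range fun i => pos (a i) := by
  classical
  set A : Finset V := Finset.univ.filter fun v => pos v ∈ σ with hA
  have hσA : (σ : Set (Fin n → ℝ)) = pos '' A := by
    ext p
    constructor
    · intro hp
      have : p ∈ Set.range pos := hrange ▸
        T.down_closed hσ (Finset.singleton_subset_iff.2 hp) (Finset.singleton_nonempty p)
      obtain ⟨v, rfl⟩ := this
      exact ⟨v, by simpa [hA] using hp, rfl⟩
    · rintro ⟨v, hv, rfl⟩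
      simpa [hA] using hv
  have hne : A.Nonempty := by
    rw [← Finset.coe_nonempty, ← Set.image_nonempty (f := pos), ← hσA]
    exact T.nonempty_of_mem_faces hσ
  obtain ⟨d, hd⟩ : ∃ d, A.card = d + 1 := ⟨A.card - 1, by have := hne.card_pos; omega⟩
  refine ⟨d, A.orderEmbOfFin hd, (A.orderEmbOfFin hd).strictMono, ?_⟩
  rw [hσA, ← Finset.range_orderEmbOfFin A hd, ← Set.range_comp]
  rfl

theorem simplices_refinedComplex_eq_iUnion (hinj : Function.Injective pos)
    (hrange : Set.range pos = T.vertices) (hc : 0 < c) :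
    simplices (refinedComplex T pos hinj hrange c hc) =
      {C | ∃ (d : ℕ) (a : Fin (d + 1) → V), ((∀ i j, i < j → a i < a j) ∧
        ∃ s ∈ T.faces, (s : Set (Fin n → ℝ)) = Set.range fun i => pos (a i)) ∧
        C ∈ canonicalTriangulation c fun i => pos (a i)} := by
  rw [simplices_refinedComplex]
  ext C
  constructor
  · rintro ⟨σ, hσ, hC⟩
    obtain ⟨d, a, ha, hσa⟩ := exists_strictMono_range_eq hrange hσ
    refine ⟨d, a, ⟨fun i j h => ha h, σ, hσ, hσa⟩, ?_⟩
    rw [canonicalTriangulation_eq hinj ha hc, ← hσa]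
    exact hC
  · rintro ⟨d, a, ⟨ha, σ, hσ, hσa⟩, hC⟩
    rw [canonicalTriangulation_eq hinj (fun i j h => ha i j h) hc, ← hσa] at hC
    exact ⟨σ, hσ, hC⟩

theorem simplices_refinedComplex_subset_eq (hinj : Function.Injective pos)
    (hrange : Set.range pos = T.vertices) (hc : 0 < c) {d : ℕ} {a : Fin (d + 1) → V}
    (ha : ∀ i j, i < j → a i < a j)
    (hσ : ∃ s ∈ T.faces, (s : Set (Fin n → ℝ)) = Set.range fun i => pos (a i)) :
    {C | C ∈ simplices (refinedComplex T pos hinj hrange c hc) ∧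
      C ⊆ (c : ℝ) • convexHull ℝ (Set.range fun i => pos (a i))} =
      canonicalTriangulation c fun i => pos (a i) := by
  obtain ⟨σ, hσ, hσa⟩ := hσ
  rw [canonicalTriangulation_eq hinj (fun i j h => ha i j h) hc, ← hσa,
    simplices_refinedComplex_subset hinj hrange hc hσ]

end Main

theorem exists_canonicalRefinement {n : ℕ} {P : Set (Fin n → ℝ)} (hP : IsLatticePolytope P)
    {c : ℕ} (hc : 0 < c) (T : SimplicialComplex ℝ (Fin n → ℝ)) (ord : LinearOrder T.vertices)
    (hT : IsLatticeTriangulation T P) :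
    ∃ T' : SimplicialComplex ℝ (Fin n → ℝ),
      simplices T' = canonicalRefinement T ord c ∧
      IsLatticeTriangulation T' ((c : ℝ) • P) ∧
      (∀ (d : ℕ) (a : Fin (d + 1) → T.vertices), IsOrderedFace T ord a →
        {C | C ∈ simplices T' ∧
          C ⊆ (c : ℝ) • convexHull ℝ (Set.range fun i => (a i : Fin n → ℝ))} =
          canonicalTriangulation c (fun i => (a i : Fin n → ℝ))) ∧
      (IsUnimodular T → IsUnimodular T') ∧
      (IsRegular T P → IsRegular T' ((c : ℝ) • P)) ∧
      (IsFlag T → IsFlag T') := by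
  classical
  have hvfin : T.vertices.Finite := by
    rw [SimplicialComplex.vertices_eq]
    exact hT.finite.biUnion fun s _ => s.finite_toSet
  have : Fintype T.vertices := hvfin.fintype
  have hinj : Function.Injective ((↑) : T.vertices → Fin n → ℝ) := Subtype.val_injective
  have hrange : Set.range ((↑) : T.vertices → Fin n → ℝ) = T.vertices := Subtype.range_coe
  -- The order is passed explicitly: it is the prescribed `ord`, unrelated to the coordinatewise
  -- order of ℝⁿ.
  refine ⟨@refinedComplex n T.vertices ord this T _ hinj hrange c hc, ?_, ?_, ?_, ?_, ?_, ?_⟩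
  · exact @simplices_refinedComplex_eq_iUnion n T.vertices ord this T _ c hinj hrange hc
  · exact @isLatticeTriangulation_refinedComplex n T.vertices ord this T _ c hinj hrange hc P hT
  · intro d a ha
    exact @simplices_refinedComplex_subset_eq n T.vertices ord this T _ c hinj hrange hc d a
      ha.1 ha.2
  · exact @isUnimodular_refinedComplex n T.vertices this T _ c ord hinj hrange hc hT.finite
      hT.vertices_subset
  · exact @isRegular_refinedComplex n T.vertices ord this T _ c hinj hrange hc P hP hT
  · exact @isFlag_refinedComplex n T.vertices ord this T _ c hinj hrange hc

end LatticeTriang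

open LatticeTriang
theorem mainTheorem4 {n : ℕ} (P : Set (Fin n → ℝ)) (hP : IsLatticePolytope P)
    (c : ℕ) (hc : 0 < c) :
    (∀ (T : SimplicialComplex ℝ (Fin n → ℝ)) (ord : LinearOrder T.vertices),
      IsLatticeTriangulation T P →
        ∃ T' : SimplicialComplex ℝ (Fin n → ℝ),
          simplices T' = canonicalRefinement T ord c ∧
          IsLatticeTriangulation T' ((c : ℝ) • P) ∧
          (∀ (d : ℕ) (a : Fin (d + 1) → T.vertices), IsOrderedFace T ord a →
            {C | C ∈ simplices T' ∧
              C ⊆ (c : ℝ) • convexHull ℝ (Set.range fun i => (a i : Fin n → ℝ))} =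
              canonicalTriangulation c (fun i => (a i : Fin n → ℝ))) ∧
          (IsUnimodular T → IsUnimodular T') ∧
          (IsRegular T P → IsRegular T' ((c : ℝ) • P)) ∧
          (IsFlag T → IsFlag T')) ∧
    ((∃ T : SimplicialComplex ℝ (Fin n → ℝ), IsQuadraticTriangulation T P) →
      ∃ T' : SimplicialComplex ℝ (Fin n → ℝ), IsQuadraticTriangulation T' ((c : ℝ) • P)) := by
  refine ⟨exists_canonicalRefinement hP hc, ?_⟩
  rintro ⟨T, hT⟩
  classical
  -- Any total order on the vertices serves; a well-ordering provides one.
  obtain ⟨T', -, htri, -, hu, hr, hf⟩ := exists_canonicalRefinement hP hc T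
    (@IsWellOrder.linearOrder _ (WellOrderingRel (α := T.vertices)) _) hT.triangulation
  exact ⟨T', htri, hr hT.regular, hu hT.unimodular, hf hT.flag⟩
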